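/- Let $k$ be an algebraically closed field of characteristic zero, let $X\subseteq\mathbb P^r=\mathbb P(V)$ be a nondegenerate (irreducible and reduced) projective variety over $k$, and let $q\ge 1$ be an integer. \emph{Definitions.} For a linear subspace $\Lambda\subset\mathbb P^r$, let $\pi_\Lambda$ be the linear projection from $\Lambda$, let $X_\Lambda$ be the Zariski closure of $\pi_\Lambda(X\setminus\Lambda)$, and for a finite set $\Gamma\subset X$ put $\Gamma_\Lambda=\pi_\Lambda(\Gamma\setminus\Lambda)$. Linear forms on the target of $\pi_\Lambda$ are identified with the linear forms on $\mathbb P^r$ that vanish on $\Lambda$. A linear matrix (matrix of linear forms) $M$ of size $a\times b$ is $1$-generic if $AMB^T$ has no zero entry for any $(A,B)\in GL(a)\times GL(b)$. A $(p,q)$-scroll matrix of $X$ is a $1$-generic linear matrix of size $(q+1)\times(p+q)$ whose $2$-minors vanish on $X$. It is $\Gamma$-regular, for a finite set $\Gamma\subset X$, if $\bigcap_{y\in\Gamma}\ker M(y)$ (right null spaces) has codimension $|\Gamma|$. Let $\Sigma_{p,q}(X,\Gamma)$ be the set of $\Gamma$-regular $(p,q)$-scroll matrices of $X$ modulo the action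 $(A,B)\cdot M=AMB^T$ of $GL(q+1)\times GL(p+q)$; the sets $\Sigma_{p',q}(X_\Lambda,\Gamma_\Lambda)$ are defined in the same way. For a point $z\in\Gamma$ and $[M]\in\Sigma_{p,q}(X,\Gamma)$, choose a representative $M$ such that $M(z)$ has its upper left entry as its only nonzero entry; then $\pi_z[M]$ is the class of the matrix obtained from $M$ by deleting its first column, a matrix of linear forms vanishing at $z$. This class does not depend on the choice. The operations $\pi_{\overline w}$ on $\Sigma_{p-1,q}(X_z,\Gamma_z)$ and $\pi_{\overline z}$ on $\Sigma_{p-1,q}(X_w,\Gamma_w)$, where $\overline w=\pi_z(w)$ and $\overline z=\pi_w(z)$, are defined in the same way. \textbf{Proposition (Gluing for scroll matrices I).} Let $p\ge 3$ and $n$ be integers. For a general finite set $\Gamma\subset X$ of $n$ points (that is, for every $n$-tuple of distinct points in some Zariski-open dense subset of $X^n$) and any two distinct points $z,w\in\Gamma$, the operations $\pi_{\overline w}$ and $\pi_{\overline z}$ map $\Sigma_{p-1,q}(X_z,\Gamma_z)$ and $\Sigma_{p-1,q}(X_w,\Gamma_w)$ into $\Sigma_{p-2,q}(X_{\langle z,w\rangle},\Gamma_{\langle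 z,w\rangle})$, and the map $$[M]\mapsto(\pi_z[M],\pi_w[M])$$ is a bijection from $\Sigma_{p,q}(X,\Gamma)$ onto the set of pairs $$([M_z],[M_w])\in\Sigma_{p-1,q}(X_z,\Gamma_z)\times\Sigma_{p-1,q}(X_w,\Gamma_w)\quad\text{with}\quad\pi_{\overline w}[M_z]=\pi_{\overline z}[M_w].$$ -/

import Mathlib

open scoped LinearAlgebra.Projectivization Topology

namespace ScrollGluing

section Zariski

variable (k : Type*) [Field k] (W : Type*) [AddCommGroup W] [Module k W]

/-- The Zariski topology on the projective space `ℙ k W`. Homogeneous forms on `W` are written as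
homogeneous polynomials whose variables are the linear forms on `W`; the sets `F ≠ 0` are closed
under finite intersections, and are the basic open sets. -/
@[reducible] def zariski : TopologicalSpace (ℙ k W) :=
  TopologicalSpace.generateFrom
    {D | ∃ (F : MvPolynomial (Module.Dual k W) k) (d : ℕ), F.IsHomogeneous d ∧
      D = {x | MvPolynomial.eval (fun φ : Module.Dual k W => φ x.rep) F ≠ 0}}

/-- The Zariski topology on the `n`-fold product of the projective space `ℙ k W` (finer than the
product of the topologies of the factors): the basic open sets are `F ≠ 0` for multihomogeneous
`F`, where the variable `(i, φ)` is the linear form `φ` on the `i`-th factor. -/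
@[reducible] def zariskiPi (n : ℕ) : TopologicalSpace (Fin n → ℙ k W) :=
  TopologicalSpace.generateFrom
    {D | ∃ (F : MvPolynomial (Fin n × Module.Dual k W) k) (d : Fin n → ℕ),
      F.IsWeightedHomogeneous
        (fun s : Fin n × Module.Dual k W => (Pi.single s.1 1 : Fin n → ℕ)) d ∧
      D = {P | MvPolynomial.eval (fun s : Fin n × Module.Dual k W => s.2 (P s.1).rep) F ≠ 0}}

variable {k W}

/-- A projective variety (irreducible and reduced), as its set of points. -/
def IsProjVariety (X : Set (ℙ k W)) : Prop :=
  @IsClosed _ (zariski k W) X ∧ @IsIrreducible _ (zariski k W) X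

/-- `X` lies in no hyperplane. -/
def IsNondegenerate (X : Set (ℙ k W)) : Prop :=
  ∀ φ : Module.Dual k W, (∀ x ∈ X, φ x.rep = 0) → φ = 0

/-- `π_Λ(Y ∖ Λ)`, the image of `Y ∖ Λ` in `ℙ(W/Λ)` under the linear projection from `Λ`. -/
def projSet (Λ : Submodule k W) (Y : Set (ℙ k W)) : Set (ℙ k (W ⧸ Λ)) :=
  {y | ∃ x ∈ Y, ∃ h : Λ.mkQ x.rep ≠ 0, y = Projectivization.mk k (Λ.mkQ x.rep) h}

/-- The projected variety `X_Λ`, the Zariski closure of `π_Λ(X ∖ Λ)`. -/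
def projVariety (Λ : Submodule k W) (X : Set (ℙ k W)) : Set (ℙ k (W ⧸ Λ)) :=
  @closure _ (zariski k (W ⧸ Λ)) (projSet Λ X)

end Zariski

section Matrices

variable {k : Type*} [Field k]

/-- An `a × b` matrix of linear forms on `W`. -/
abbrev LinMat (k : Type*) [Field k] (W : Type*) [AddCommGroup W] [Module k W] (a b : ℕ) :=
  Matrix (Fin a) (Fin b) (Module.Dual k W)

variable {W W' : Type*} [AddCommGroup W] [Module k W] [AddCommGroup W'] [Module k W']
  {a b b' : ℕ}

/-- The product `A M Bᵀ` of a linear matrix `M` with scalar matrices `A`, `B`. -/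
def act (A : Matrix (Fin a) (Fin a) k) (B : Matrix (Fin b) (Fin b) k) (M : LinMat k W a b) :
    LinMat k W a b :=
  fun i j => ∑ s, ∑ t, (A i s * B j t) • M s t

/-- The value `M(v)` of a linear matrix at a vector `v`. -/
def evalAt (M : LinMat k W a b) (v : W) : Matrix (Fin a) (Fin b) k :=
  fun i j => M i j v

theorem act_one (M : LinMat k W a b) : act 1 1 M = M := by
  ext i j v
  simp [act, Matrix.one_apply]

theorem act_act (A A' : Matrix (Fin a) (Fin a) k) (B B' : Matrix (Fin b) (Fin b) k)
    (M : LinMat k W a b) : act A B (act A' B' M) = act (A * A') (B * B') M := by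
  ext i j v
  have h : ∀ N : LinMat k W a b, ∀ (A : Matrix (Fin a) (Fin a) k) (B : Matrix (Fin b) (Fin b) k),
      evalAt (act A B N) v = A * evalAt N v * B.transpose := by
    intro N A B
    ext i j
    simp only [evalAt, act, Matrix.mul_apply, Matrix.transpose_apply, LinearMap.sum_apply,
      LinearMap.smul_apply, smul_eq_mul, Finset.sum_mul]
    rw [Finset.sum_comm]
    exact Finset.sum_congr rfl fun _ _ => Finset.sum_congr rfl fun _ _ => by ring
  have := congrFun (congrFun ((h (act A' B' M) A B).trans ?_ :
    _ = evalAt (act (A * A') (B * B') M) v) i) j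
  · exact this
  · rw [h, h, Matrix.transpose_mul]
    simp only [Matrix.mul_assoc]

/-- Equivalence of linear matrices under `GL(a) × GL(b)`. -/
instance linMatSetoid (k : Type*) [Field k] (W : Type*) [AddCommGroup W] [Module k W] (a b : ℕ) :
    Setoid (LinMat k W a b) where
  r M M' := ∃ (A : GL (Fin a) k) (B : GL (Fin b) k), M' = act A.val B.val M
  iseqv :=
    { refl := fun M => ⟨1, 1, (act_one M).symm⟩
      symm := by
        rintro M _ ⟨A, B, rfl⟩
        refine ⟨A⁻¹, B⁻¹, ?_⟩
        rw [act_act, ← Units.val_mul, ← Units.val_mul, inv_mul_cancel, inv_mul_cancel]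
        exact (act_one M).symm
      trans := by
        rintro M _ _ ⟨A, B, rfl⟩ ⟨A', B', rfl⟩
        exact ⟨A' * A, B' * B, act_act _ _ _ _ _⟩ }

/-- Classes `[M]` of `a × b` linear matrices modulo `GL(a) × GL(b)`. -/
abbrev LinClass (k : Type*) [Field k] (W : Type*) [AddCommGroup W] [Module k W] (a b : ℕ) :=
  Quotient (linMatSetoid k W a b)

/-- `M` is `1`-generic: no `A M Bᵀ` with `A`, `B` invertible has a zero entry. -/
def OneGeneric (M : LinMat k W a b) : Prop :=
  ∀ (A : GL (Fin a) k) (B : GL (Fin b) k) (i : Fin a) (j : Fin b), act A.val B.val M i j ≠ 0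

/-- The `2`-minors of `M` vanish on `X`. -/
def MinorsVanish (X : Set (ℙ k W)) (M : LinMat k W a b) : Prop :=
  ∀ x ∈ X, ∀ (i i' : Fin a) (j j' : Fin b),
    M i j x.rep * M i' j' x.rep - M i j' x.rep * M i' j x.rep = 0

/-- `M` is a `(p,q)`-scroll matrix of `X`. -/
def IsScrollMatrix (X : Set (ℙ k W)) (p q : ℕ) (M : LinMat k W (q + 1) (p + q)) : Prop :=
  OneGeneric M ∧ MinorsVanish X M

/-- `M` is `Γ`-regular: `⋂_{z ∈ Γ} ker M(z)` has codimension `|Γ|`. -/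
def IsRegularAt (Γ : Set (ℙ k W)) (M : LinMat k W a b) : Prop :=
  Module.finrank k ((Fin b → k) ⧸ ⨅ z ∈ Γ, LinearMap.ker (evalAt M z.rep).mulVecLin) = Γ.ncard

/-- `Σ_{p,q}(X,Γ)`: the classes of `Γ`-regular `(p,q)`-scroll matrices of `X`. -/
def scrollClasses (p q : ℕ) (X Γ : Set (ℙ k W)) : Set (LinClass k W (q + 1) (p + q)) :=
  {c | ∃ M : LinMat k W (q + 1) (p + q), ⟦M⟧ = c ∧ IsScrollMatrix X p q M ∧ IsRegularAt Γ M}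

/-- Let `f : W → W'` be the linear projection from the point represented by `v`. Then
`DeletesColumn f v hb M N` says that `M` has an equivalent matrix `A M Bᵀ` whose value at `v` has
its upper left entry as its only nonzero entry, and that deleting the first column of `A M Bᵀ`
gives `N`, where linear forms on `W'` are linear forms on `W` through `f`. -/
def DeletesColumn (f : W →ₗ[k] W') (v : W) (hb : b = b' + 1)
    (M : LinMat k W a b) (N : LinMat k W' a b') : Prop :=
  ∃ (A : GL (Fin a) k) (B : GL (Fin b) k),
    (∀ i j, evalAt (act A.val B.val M) v i j ≠ 0 ↔ (i.val = 0 ∧ j.val = 0)) ∧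
    ∀ (i : Fin a) (j : Fin b'),
      (N i j).comp f = act A.val B.val M i ⟨j.val + 1, by have := j.isLt; omega⟩

open Classical in
/-- The operation `π_z` on classes, for the projection `f` from the point `z` represented by `v`:
`[M]` goes to the class of the matrix obtained from a representative with `M(z) = E^{0,0}` by
deleting the first column. If there is no such representative, the value is `[0]`. -/
noncomputable def innerProj (f : W →ₗ[k] W') (v : W) (hb : b = b' + 1)
    (c : LinClass k W a b) : LinClass k W' a b' :=
  if h : ∃ N : LinMat k W' a b', ∃ M : LinMat k W a b, ⟦M⟧ = c ∧ DeletesColumn f v hb M N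
  then ⟦h.choose⟧ else ⟦0⟧

/-- `innerProj` does not depend on the choices. -/
theorem deletesColumn_unique (f : W →ₗ[k] W') (hf : Function.Surjective f) (v : W)
    (hb : b = b' + 1) {M M' : LinMat k W a b} {N N' : LinMat k W' a b'} (hM : M ≈ M')
    (h : DeletesColumn f v hb M N) (h' : DeletesColumn f v hb M' N') : N ≈ N' := by
  subst hb
  obtain ⟨A, B, h0, h1⟩ := h
  obtain ⟨A', B', h0', h1'⟩ := h'
  have hequiv : act A.val B.val M ≈ act A'.val B'.val M' :=
    Setoid.trans (Setoid.symm (⟨A, B, rfl⟩ : M ≈ act A.val B.val M))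
      (Setoid.trans hM (⟨A', B', rfl⟩ : M' ≈ act A'.val B'.val M'))
  obtain ⟨P, Q, hPQ⟩ := hequiv
  generalize act A.val B.val M = M1 at *
  generalize act A'.val B'.val M' = M2 at *
  subst hPQ
  rcases Nat.eq_zero_or_pos a with rfl | ha
  · have : N = N' := by
      ext i
      exact i.elim0
    exact this ▸ Setoid.refl _
  obtain ⟨a, rfl⟩ : ∃ a0, a = a0 + 1 := ⟨a - 1, by omega⟩
  have hval : ∀ i j, evalAt (act P.val Q.val M1) v i j
      = P.val i 0 * Q.val j 0 * evalAt M1 v 0 0 := by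
    intro i j
    simp only [evalAt, act, LinearMap.sum_apply, LinearMap.smul_apply, smul_eq_mul]
    rw [Finset.sum_eq_single 0, Finset.sum_eq_single 0]
    · intro t _ ht
      have : M1 0 t v = 0 := by
        by_contra hne
        exact ht (Fin.ext ((h0 0 t).1 hne).2)
      rw [this, mul_zero]
    · simp
    · intro s _ hs
      refine Finset.sum_eq_zero fun t _ => ?_
      have : M1 s t v = 0 := by
        by_contra hne
        exact hs (Fin.ext ((h0 s t).1 hne).1)
      rw [this, mul_zero]
    · simp
  have h00 : evalAt M1 v 0 0 ≠ 0 := (h0 0 0).2 ⟨rfl, rfl⟩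
  have hP0 : P.val 0 0 * Q.val 0 0 * evalAt M1 v 0 0 ≠ 0 := by
    rw [← hval]; exact (h0' 0 0).2 ⟨rfl, rfl⟩
  have hP : P.val 0 0 ≠ 0 := fun h => hP0 (by rw [h, zero_mul, zero_mul])
  have hQ0 : ∀ j : Fin b', Q.val j.succ 0 = 0 := by
    intro j
    by_contra hne
    have := (h0' 0 j.succ).1 (by rw [hval]; exact mul_ne_zero (mul_ne_zero hP hne) h00)
    simp at this
  have hdet : Q.val.det = Q.val 0 0 * (Q.val.submatrix Fin.succ Fin.succ).det := by
    rw [Matrix.det_succ_column_zero, Fin.sum_univ_succ]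
    simp [hQ0]
  have hQdet : Q.val.det ≠ 0 := (Matrix.GeneralLinearGroup.det Q).ne_zero
  have hQ'det : (Q.val.submatrix Fin.succ Fin.succ).det ≠ 0 := by
    intro h; exact hQdet (by rw [hdet, h, mul_zero])
  refine ⟨P, Matrix.GeneralLinearGroup.mkOfDetNeZero _ hQ'det, ?_⟩
  ext i j x
  obtain ⟨y, rfl⟩ := hf x
  have e : ∀ i j, N i j (f y) = M1 i (Fin.succ j) y := fun i j =>
    congrArg (fun φ : Module.Dual k W => φ y) (h1 i j)
  have e' : N' i j (f y) = act P.val Q.val M1 i (Fin.succ j) y :=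
    congrArg (fun φ : Module.Dual k W => φ y) (h1' i j)
  rw [e']
  simp only [act, LinearMap.sum_apply, LinearMap.smul_apply, e,
    Matrix.GeneralLinearGroup.mkOfDetNeZero]
  refine Finset.sum_congr rfl fun s _ => ?_
  rw [Fin.sum_univ_succ, hQ0]
  simp

theorem innerProj_mk (f : W →ₗ[k] W') (hf : Function.Surjective f) (v : W) (hb : b = b' + 1)
    {M : LinMat k W a b} {N : LinMat k W' a b'} (h : DeletesColumn f v hb M N) :
    innerProj f v hb ⟦M⟧ = ⟦N⟧ := by
  have hex : ∃ N : LinMat k W' a b', ∃ M' : LinMat k W a b,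
    (⟦M'⟧ : LinClass k W a b) = ⟦M⟧ ∧ DeletesColumn f v hb M' N := ⟨N, M, rfl, h⟩
  rw [innerProj, dif_pos hex]
  obtain ⟨M', hM', hd⟩ := hex.choose_spec
  exact Quotient.sound (deletesColumn_unique f hf v hb (Quotient.exact hM') hd h)

end Matrices

end ScrollGluing

/-!
The class of a linear matrix `M` with independent columns, modulo `GL(a) × GL(b)`, is the same thing
as the `b`-dimensional space `C` spanned by its columns in `k^a ⊗ V*`, modulo `GL(a)`
(`equiv_iff_colSpace`). In these terms `M` is a scroll matrix of `X` when the values of the elements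
of `C` at each point of `X` span at most a line, and no nonzero element of `C` is annihilated by a
nonzero row vector; it is `Γ`-regular when the points of `Γ` are separated by elements of `C`
(`isScroll_iff_colSpace`). The inner projection `π_z` replaces `C` by the subspace `C_z` of the
columns that vanish at `z` (`innerProj_eq_of_colSpace`), so that `π_w̄ π_z` and `π_z̄ π_w` both give
`C_z ∩ C_w`. Matrices on a quotient of `V` are treated through the pullbacks of their columns to `V`.

Injectivity. The columns separate `z` from `w`, hence `C = C_z + C_w`. If `C'_z = A C_z` and
`C'_w = B C_w`, then `B⁻¹ A` preserves the nonzero space `D = C_z ∩ C_w`. For `g ∈ D` and `x ∈ X`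
the value `g(x)` is zero or an eigenvector of `B⁻¹ A`; since `X` is irreducible the eigenvalue is
constant, and then `1`-genericity and nondegeneracy force `B⁻¹ A` to be a scalar
(`IsScrollSpace.eq_smul_one_of_stabilizes`). Thus `C' = B C`.

Surjectivity. After a row operation, spaces `C₁` and `C₂` with equal inner projections satisfy
`C₁ ∩ {g(w) = 0} = C₂ ∩ {g(z) = 0} = D`, and they are glued to `C₁ + C₂`, whose dimension is right
because `C₁ ∩ C₂ = D`. A nonzero column `g ∈ D` does not vanish on a dense open subset of `X`, and
there all columns of `C₁` and of `C₂` are multiples of `g`; this gives the vanishing of the minors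
and `1`-genericity (`IsScrollSpace.sup`).

Generality of the points is only used for the regularity of `C₁ + C₂`: distinct points of `Γ` other
than `z` must have distinct projections from `z`, that is, no three points of `Γ` are collinear.
This condition is open, and it is dense in the tuples of points of `X` as soon as `X` spans at least
a plane (`subset_closure_noThreeCollinear`); otherwise there are no scroll matrices of the sizes in
question.
-/

namespace ScrollGluing

/-! ### Zariski-open conditions -/

section Zariski

variable {k : Type*} [Field k] {W : Type*} [AddCommGroup W] [Module k W]

theorem isOpen_eval_ne_zero {F : MvPolynomial (Module.Dual k W) k} {d : ℕ}
    (hF : F.IsHomogeneous d) :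
    IsOpen[zariski k W] {x | MvPolynomial.eval (fun φ : Module.Dual k W => φ x.rep) F ≠ 0} :=
  TopologicalSpace.isOpen_generateFrom_of_mem ⟨F, d, hF, rfl⟩

theorem isOpen_form_ne_zero (φ : Module.Dual k W) :
    IsOpen[zariski k W] {x | φ x.rep ≠ 0} := by
  simpa using isOpen_eval_ne_zero (MvPolynomial.isHomogeneous_X k φ)

theorem isOpen_minor_ne_zero (φ ψ φ' ψ' : Module.Dual k W) :
    IsOpen[zariski k W] {x | φ x.rep * ψ x.rep - φ' x.rep * ψ' x.rep ≠ 0} := by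
  have h := isOpen_eval_ne_zero
    (((MvPolynomial.isHomogeneous_X k φ).mul (MvPolynomial.isHomogeneous_X k ψ)).sub
      ((MvPolynomial.isHomogeneous_X k φ').mul (MvPolynomial.isHomogeneous_X k ψ')))
  simpa using h

/-- On an irreducible nondegenerate set, finitely many nonzero linear forms and one nonempty open
condition can be made nonzero, respectively satisfied, at a common point. -/
theorem exists_mem_forms_ne_zero {X : Set (ℙ k W)} (hX : @IsIrreducible _ (zariski k W) X)
    (hnd : IsNondegenerate X) {O : Set (ℙ k W)} (hO : IsOpen[zariski k W] O)
    (hXO : (X ∩ O).Nonempty) {ι : Type*} [Finite ι] (φ : ι → Module.Dual k W)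
    (hφ : ∀ i, φ i ≠ 0) : ∃ x ∈ X, x ∈ O ∧ ∀ i, φ i x.rep ≠ 0 := by
  classical
  let _ := zariski k W
  have := Fintype.ofFinite ι
  obtain ⟨x, hx, hxU⟩ := isIrreducible_iff_sInter.1 hX
    (insert O (Finset.univ.image fun i => {x : ℙ k W | φ i x.rep ≠ 0}))
    (by
      intro u hu
      rcases Finset.mem_insert.1 hu with rfl | hu
      · exact hO
      · obtain ⟨i, -, rfl⟩ := Finset.mem_image.1 hu
        exact isOpen_form_ne_zero (φ i))
    (by
      intro u hu
      rcases Finset.mem_insert.1 hu with rfl | hu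
      · exact hXO
      · obtain ⟨i, -, rfl⟩ := Finset.mem_image.1 hu
        by_contra hne
        refine hφ i (hnd _ fun x hx => ?_)
        by_contra h
        exact hne ⟨x, hx, h⟩)
  refine ⟨x, hx, hxU O (by simp), fun i => ?_⟩
  exact hxU {x : ℙ k W | φ i x.rep ≠ 0} (by simp)

theorem exists_mem_forms_ne_zero_of_finite {X : Set (ℙ k W)}
    (hX : @IsIrreducible _ (zariski k W) X)
    (hnd : IsNondegenerate X) {ι : Type*} [Finite ι] (φ : ι → Module.Dual k W)
    (hφ : ∀ i, φ i ≠ 0) : ∃ x ∈ X, ∀ i, φ i x.rep ≠ 0 := by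
  let _ := zariski k W
  obtain ⟨x, hx, -, h⟩ := exists_mem_forms_ne_zero hX hnd isOpen_univ
    (by simpa using hX.nonempty) φ hφ
  exact ⟨x, hx, h⟩

/-- Restricting a multihomogeneous form to one factor gives a homogeneous form, so moving a single
point of an `n`-tuple is Zariski continuous. -/
theorem continuous_update {n : ℕ} (P : Fin n → ℙ k W) (m : Fin n) :
    Continuous[zariski k W, zariskiPi k W n] (fun x => Function.update P m x) := by
  let _ := zariski k W
  refine continuous_generateFrom_iff.2 ?_
  rintro _ ⟨F, d, hF, rfl⟩
  let g : Fin n × Module.Dual k W → MvPolynomial (Module.Dual k W) k := fun s =>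
    if s.1 = m then MvPolynomial.X s.2 else MvPolynomial.C (s.2 (P s.1).rep)
  have hg : ∀ s, (g s).IsHomogeneous ((Pi.single s.1 1 : Fin n → ℕ) m) := by
    intro s
    by_cases h : s.1 = m
    · simpa [g, h] using MvPolynomial.isHomogeneous_X k s.2
    · simpa [g, h, Pi.single_apply, Ne.symm h] using
        MvPolynomial.isHomogeneous_C (Module.Dual k W) (s.2 (P s.1).rep)
  have hhom : (MvPolynomial.bind₁ g F).IsHomogeneous (d m) := by
    rw [MvPolynomial.bind₁, MvPolynomial.aeval_def, MvPolynomial.eval₂_eq]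
    refine MvPolynomial.IsHomogeneous.sum _ _ _ fun e he => ?_
    have hd : ∑ i ∈ e.support, (Pi.single i.1 1 : Fin n → ℕ) m * e i = d m := by
      rw [← hF (MvPolynomial.mem_support_iff.1 he), Finsupp.weight_apply, Finsupp.sum,
        Finset.sum_apply]
      exact Finset.sum_congr rfl fun i _ => by simp [mul_comm]
    rw [← hd]
    have h1 := MvPolynomial.IsHomogeneous.prod e.support (fun i => g i ^ e i) _
      fun i _ => (hg i).pow (e i)
    simpa using (MvPolynomial.isHomogeneous_C (Module.Dual k W) (MvPolynomial.coeff e F)).mul h1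
  convert isOpen_eval_ne_zero hhom using 1
  ext x
  simp only [Set.mem_preimage, Set.mem_ofPred_eq]
  have : MvPolynomial.eval (fun φ : Module.Dual k W => φ x.rep) (MvPolynomial.bind₁ g F) =
      MvPolynomial.eval (fun s : Fin n × Module.Dual k W => s.2 (Function.update P m x s.1).rep)
        F := by
    rw [MvPolynomial.eval, MvPolynomial.eval₂Hom_bind₁]
    congr 2
    funext s
    by_cases h : s.1 = m
    · simp [g, h]
    · simp [g, h]
  rw [this]

/-- The `n`-tuples of points, no three of which are collinear. -/
def noThreeCollinear (k W : Type*) [Field k] [AddCommGroup W] [Module k W] (n : ℕ) :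
    Set (Fin n → ℙ k W) :=
  {P | ∀ i j l, i ≠ j → i ≠ l → j ≠ l → LinearIndependent k ![(P i).rep, (P j).rep, (P l).rep]}

/-- Linear independence of three vectors is detected by a nonzero `3 × 3` determinant of values of
linear forms. -/
theorem linearIndependent_three_iff (v : Fin 3 → W) :
    LinearIndependent k v ↔
      ∃ φ : Fin 3 → Module.Dual k W, (Matrix.of fun a b => φ a (v b)).det ≠ 0 := by
  constructor
  · intro h
    obtain ⟨g, hg⟩ := (Fintype.linearCombination k v).exists_leftInverse_of_injective
      (LinearMap.ker_eq_bot.2 h.fintypeLinearCombination_injective)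
    refine ⟨fun a => LinearMap.proj a ∘ₗ g, ?_⟩
    have : (Matrix.of fun a b => (LinearMap.proj a ∘ₗ g) (v b)) =
        (1 : Matrix (Fin 3) (Fin 3) k) := by
      ext a b
      have := congrFun (LinearMap.congr_fun hg (Pi.single b 1)) a
      rw [LinearMap.comp_apply, Fintype.linearCombination_apply_single, one_smul] at this
      simpa [Matrix.one_apply, Pi.single_apply] using this
    rw [this]
    simp
  · rintro ⟨φ, hφ⟩
    rw [Fintype.linearIndependent_iff]
    intro c hc
    have : (Matrix.of fun a b => φ a (v b)).mulVec c = 0 := by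
      ext a
      have := congrArg (φ a) hc
      simpa [Matrix.mulVec, dotProduct, mul_comm] using this
    exact congrFun (Matrix.eq_zero_of_mulVec_eq_zero hφ this)

theorem isOpen_noThreeCollinear (n : ℕ) :
    IsOpen[zariskiPi k W n] (noThreeCollinear k W n) := by
  let _ := zariskiPi k W n
  simp only [noThreeCollinear, Set.ofPred_forall]
  refine isOpen_iInter_of_finite fun i => isOpen_iInter_of_finite fun j =>
    isOpen_iInter_of_finite fun l => isOpen_iInter_of_finite fun _ =>
    isOpen_iInter_of_finite fun _ => isOpen_iInter_of_finite fun _ => ?_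
  simp only [linearIndependent_three_iff, Set.ofPred_exists]
  refine isOpen_iUnion fun φ => TopologicalSpace.isOpen_generateFrom_of_mem ?_
  let x : Fin 3 → Fin n → MvPolynomial (Fin n × Module.Dual k W) k :=
    fun a i => MvPolynomial.X (i, φ a)
  let w : Fin n × Module.Dual k W → (Fin n → ℕ) := fun s => Pi.single s.1 1
  have hx : ∀ a i, (x a i).IsWeightedHomogeneous w (Pi.single i 1) := fun a i =>
    MvPolynomial.isWeightedHomogeneous_X k w (i, φ a)
  have hm : ∀ a b c, (x a i * x b j * x c l).IsWeightedHomogeneous w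
      (Pi.single i 1 + Pi.single j 1 + Pi.single l 1) := fun a b c =>
    ((hx a i).mul (hx b j)).mul (hx c l)
  refine ⟨_, _, (((((hm 0 1 2).sub (hm 0 2 1)).sub (hm 1 0 2)).add (hm 2 0 1)).add
    (hm 1 2 0)).sub (hm 2 1 0), ?_⟩
  ext P
  simp only [Set.mem_ofPred_eq, x, Matrix.det_fin_three]
  refine not_congr (Eq.congr ?_ rfl)
  simp
  ring

/-- A general tuple of points of a nondegenerate irreducible set that spans at least a plane has no
three collinear points: each point in turn is moved off hyperplanes containing the lines through
pairs of preceding points. -/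
theorem subset_closure_noThreeCollinear [FiniteDimensional k W] {X : Set (ℙ k W)}
    (hX : @IsIrreducible _ (zariski k W) X)
    (hnd : IsNondegenerate X) (hW : 3 ≤ Module.finrank k W) (n : ℕ) :
    {P | ∀ i, P i ∈ X} ⊆
      @closure _ (zariskiPi k W n) (noThreeCollinear k W n ∩ {P | ∀ i, P i ∈ X}) := by
  let _ := zariskiPi k W n
  intro P hP
  rw [mem_closure_iff]
  intro O hO hPO
  have hline : ∀ u v : W, ∃ φ : Module.Dual k W, φ ≠ 0 ∧ φ u = 0 ∧ φ v = 0 := by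
    intro u v
    have hlt : Submodule.span k (Set.range ![u, v]) < ⊤ := by
      refine lt_top_iff_ne_top.2 fun h => ?_
      have h1 : (Set.range ![u, v]).finrank k ≤ 2 := by
        simpa using finrank_range_le_card (R := k) ![u, v]
      rw [Set.finrank, h, finrank_top] at h1
      omega
    obtain ⟨φ, hφ, h⟩ := Submodule.exists_le_ker_of_lt_top _ hlt
    exact ⟨φ, hφ, h (Submodule.subset_span ⟨0, rfl⟩), h (Submodule.subset_span ⟨1, rfl⟩)⟩
  -- `m` is the number of points already in general position: each lies on no line spanned by, and
  -- coincides with none of, the preceding ones.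
  have key : ∀ m : ℕ, m ≤ n → ∃ Q ∈ O, (∀ i, Q i ∈ X) ∧
      ∀ i j l : Fin n, i < l → j < l → l.val < m →
        ∃ φ : Module.Dual k W, φ (Q i).rep = 0 ∧ φ (Q j).rep = 0 ∧ φ (Q l).rep ≠ 0 := by
    intro m
    induction m with
    | zero => exact fun _ => ⟨P, hPO, hP, fun _ _ _ _ _ h => absurd h (Nat.not_lt_zero _)⟩
    | succ m ih =>
      intro hm
      obtain ⟨Q, hQO, hQX, hQ⟩ := ih (Nat.le_of_succ_le hm)
      let l : Fin n := ⟨m, hm⟩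
      choose φ hφ hφ1 hφ2 using fun s : Fin n × Fin n => hline (Q s.1).rep (Q s.2).rep
      obtain ⟨x, hxX, hxO, hx⟩ := exists_mem_forms_ne_zero hX hnd
        (@IsOpen.preimage _ _ (zariski k W) _ _ (continuous_update Q l) _ hO)
        ⟨Q l, hQX l, by simpa using hQO⟩ φ hφ
      refine ⟨Function.update Q l x, hxO, fun i => ?_, fun i j l' hi hj hl' => ?_⟩
      · by_cases h : i = l
        · subst h; simpa using hxX
        · simpa [h] using hQX i
      · have hne : ∀ i : Fin n, i < l' → i ≠ l := fun i hi h => by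
          have h1 := Fin.lt_def.1 hi
          have h2 : i.val = m := congrArg Fin.val h
          omega
        rw [Function.update_of_ne (hne i hi), Function.update_of_ne (hne j hj)]
        by_cases h : l' = l
        · subst h
          exact ⟨φ (i, j), hφ1 (i, j), hφ2 (i, j), by simpa using hx (i, j)⟩
        · rw [Function.update_of_ne h]
          refine hQ i j l' hi hj ?_
          have h2 : l'.val ≠ m := fun h' => h (Fin.ext h')
          omega
  obtain ⟨Q, hQO, hQX, hQ⟩ := key n le_rfl
  refine ⟨Q, hQO, ?_, hQX⟩
  have hQ' : ∀ i j l : Fin n, i < l → j < l →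
      (Q l).rep ∉ Submodule.span k {(Q i).rep, (Q j).rep} := by
    intro i j l hi hj hmem
    obtain ⟨φ, h1, h2, h3⟩ := hQ i j l hi hj l.isLt
    have hle : Submodule.span k {(Q i).rep, (Q j).rep} ≤ LinearMap.ker φ := by
      rw [Submodule.span_le]
      rintro _ (rfl | rfl)
      exacts [h1, h2]
    exact h3 (hle hmem)
  have hinj : Function.Injective Q := by
    intro i j h
    by_contra hij
    rcases lt_or_gt_of_ne hij with hlt | hlt
    · exact hQ' i i j hlt hlt (by rw [← h]; exact Submodule.subset_span (by simp))
    · exact hQ' j j i hlt hlt (by rw [h]; exact Submodule.subset_span (by simp))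
  have hsorted : ∀ i j l : Fin n, i < l → j < l → i ≠ j →
      LinearIndependent k ![(Q l).rep, (Q i).rep, (Q j).rep] := by
    intro i j l hi hj hij
    refine linearIndependent_finCons.2 ⟨?_, by
      simpa [Set.pair_comm] using hQ' i j l hi hj⟩
    have := (Projectivization.linearIndependent_pair_iff_ne).2 (hinj.ne hij)
    simpa using this
  intro i j l hij hil hjl
  -- Whichever of the three indices is the largest, a permutation reduces to the sorted case.
  have hperm : ∀ (v : Fin 3 → W) (σ : Fin 3 → Fin 3), Function.Injective σ →
      LinearIndependent k v → LinearIndependent k ![v (σ 0), v (σ 1), v (σ 2)] := by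
    intro v σ hσ h
    convert h.comp σ hσ using 1
    funext a
    fin_cases a <;> rfl
  by_cases h1 : i < l ∧ j < l
  · exact hperm ![(Q l).rep, (Q i).rep, (Q j).rep] ![1, 2, 0] (by decide) (hsorted i j l h1.1 h1.2 hij)
  by_cases h2 : i < j ∧ l < j
  · exact hperm ![(Q j).rep, (Q i).rep, (Q l).rep] ![1, 0, 2] (by decide) (hsorted i l j h2.1 h2.2 hil)
  · exact hsorted j l i (by omega) (by omega) hjl

end Zariski

/-! ### Linear matrices and their column spaces -/

section ColumnSpaces

variable {k : Type*} [Field k] {V W W' : Type*} [AddCommGroup V] [Module k V]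
  [AddCommGroup W] [Module k W] [AddCommGroup W'] [Module k W'] {a b b' : ℕ}

/-- The value at a vector `v` of a column of linear forms. -/
def evalCol (a : ℕ) (v : W) : (Fin a → Module.Dual k W) →ₗ[k] (Fin a → k) where
  toFun g i := g i v
  map_add' _ _ := rfl
  map_smul' _ _ := rfl

@[simp] theorem evalCol_apply (v : W) (g : Fin a → Module.Dual k W) (i : Fin a) :
    evalCol a v g i = g i v := rfl

/-- Left multiplication of columns of linear forms by a scalar matrix. -/
def rowMul (A : Matrix (Fin a) (Fin a) k) :
    (Fin a → Module.Dual k W) →ₗ[k] (Fin a → Module.Dual k W) where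
  toFun g i := ∑ s, A i s • g s
  map_add' g h := by
    funext i
    simp [Finset.sum_add_distrib]
  map_smul' c g := by
    funext i
    simp [Finset.smul_sum, smul_comm c]

theorem rowMul_apply (A : Matrix (Fin a) (Fin a) k) (g : Fin a → Module.Dual k W) (i : Fin a) :
    rowMul A g i = ∑ s, A i s • g s := rfl

theorem evalCol_rowMul (v : W) (A : Matrix (Fin a) (Fin a) k) (g : Fin a → Module.Dual k W) :
    evalCol a v (rowMul A g) = A.mulVec (evalCol a v g) := by
  funext i
  simp [rowMul_apply, Matrix.mulVec, dotProduct]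

theorem rowMul_mul (A B : Matrix (Fin a) (Fin a) k) :
    rowMul (W := W) (A * B) = rowMul A ∘ₗ rowMul B := by
  refine LinearMap.ext fun g => funext fun i => LinearMap.ext fun v => ?_
  have h := congrFun (evalCol_rowMul v (A * B) g) i
  rw [← Matrix.mulVec_mulVec, ← evalCol_rowMul, ← evalCol_rowMul] at h
  exact h

theorem rowMul_one : rowMul (W := W) (1 : Matrix (Fin a) (Fin a) k) = LinearMap.id := by
  ext g i v
  simp [rowMul_apply, Matrix.one_apply]

theorem rowMul_smul_one (s : k) (g : Fin a → Module.Dual k W) :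
    rowMul (s • (1 : Matrix (Fin a) (Fin a) k)) g = s • g := by
  ext i v
  simp [rowMul_apply, Matrix.one_apply]

theorem rowMul_inv_rowMul (A : GL (Fin a) k) (g : Fin a → Module.Dual k W) :
    rowMul (A⁻¹).val (rowMul A.val g) = g := by
  rw [← LinearMap.comp_apply, ← rowMul_mul, ← Units.val_mul, inv_mul_cancel, Units.val_one,
    rowMul_one, LinearMap.id_apply]

theorem map_rowMul_mul (A B : GL (Fin a) k) (C : Submodule k (Fin a → Module.Dual k W)) :
    C.map (rowMul (A * B).val) = (C.map (rowMul B.val)).map (rowMul A.val) := by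
  rw [Units.val_mul, rowMul_mul, Submodule.map_comp]

theorem map_rowMul_one (C : Submodule k (Fin a → Module.Dual k W)) :
    C.map (rowMul (1 : GL (Fin a) k).val) = C := by
  rw [Units.val_one, rowMul_one, Submodule.map_id]

theorem rowMul_injective (A : GL (Fin a) k) :
    Function.Injective (rowMul (W := W) A.val) :=
  Function.LeftInverse.injective (rowMul_inv_rowMul A)

/-- Left multiplication by an invertible matrix commutes with imposing vanishing at `v`. -/
theorem map_rowMul_inf_ker (A : GL (Fin a) k) (C : Submodule k (Fin a → Module.Dual k W)) (v : W) :
    (C ⊓ LinearMap.ker (evalCol a v)).map (rowMul A.val) =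
      C.map (rowMul A.val) ⊓ LinearMap.ker (evalCol a v) := by
  apply le_antisymm
  · rintro _ ⟨g, ⟨hg, hv⟩, rfl⟩
    refine ⟨⟨g, hg, rfl⟩, ?_⟩
    exact LinearMap.mem_ker.2 (by rw [evalCol_rowMul, LinearMap.mem_ker.1 hv, Matrix.mulVec_zero])
  · rintro _ ⟨⟨g, hg, rfl⟩, hv⟩
    refine ⟨g, ⟨hg, ?_⟩, rfl⟩
    have := evalCol_rowMul v (A⁻¹).val (rowMul A.val g)
    rw [rowMul_inv_rowMul, LinearMap.mem_ker.1 hv, Matrix.mulVec_zero] at this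
    exact this

/-- The column space of a linear matrix on `W`, pulled back along `f : V → W`. -/
def colSpace (f : V →ₗ[k] W) (M : LinMat k W a b) : Submodule k (Fin a → Module.Dual k V) :=
  Submodule.span k (Set.range fun j i => (M i j).comp f)

/-- The pullback of a column of linear forms. -/
def pullCol (a : ℕ) (f : V →ₗ[k] W) :
    (Fin a → Module.Dual k W) →ₗ[k] (Fin a → Module.Dual k V) where
  toFun g i := (g i).comp f
  map_add' _ _ := rfl
  map_smul' _ _ := rfl

/-- Columns vanishing on the kernel of a surjection descend along it. -/
theorem exists_pullCol_eq {f : V →ₗ[k] W} (hf : Function.Surjective f)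
    (g : Fin a → Module.Dual k V) (hg : ∀ v ∈ LinearMap.ker f, evalCol a v g = 0) :
    ∃ h, pullCol a f h = g := by
  obtain ⟨s, hs⟩ := f.exists_rightInverse_of_surjective (LinearMap.range_eq_top.2 hf)
  refine ⟨fun i => (g i).comp s, ?_⟩
  ext i v
  have h1 : v - s (f v) ∈ LinearMap.ker f := by
    have := LinearMap.congr_fun hs (f v)
    rw [LinearMap.mem_ker, map_sub, sub_eq_zero]
    exact this.symm
  have h2 := congrFun (hg _ h1) i
  rw [evalCol_apply, map_sub, Pi.zero_apply, sub_eq_zero] at h2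
  exact h2.symm

theorem mem_colSpace_iff {f : V →ₗ[k] W} {M : LinMat k W a b} {g : Fin a → Module.Dual k V} :
    g ∈ colSpace f M ↔ ∃ m : Fin b → k, g = fun i => ∑ j, m j • (M i j).comp f := by
  rw [colSpace, Submodule.mem_span_range_iff_exists_fun]
  refine exists_congr fun m => ?_
  rw [eq_comm]
  refine Eq.congr rfl ?_
  funext i
  simp [Finset.sum_apply]

theorem evalCol_sum (f : V →ₗ[k] W) (M : LinMat k W a b) (m : Fin b → k) (v : V) :
    evalCol a v (fun i => ∑ j, m j • (M i j).comp f) = (evalAt M (f v)).mulVec m := by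
  funext i
  simp [evalAt, Matrix.mulVec, dotProduct, mul_comm]

theorem colSpace_vanish {f : V →ₗ[k] W} {M : LinMat k W a b} {g : Fin a → Module.Dual k V}
    (hg : g ∈ colSpace f M) {v : V} (hv : f v = 0) : evalCol a v g = 0 := by
  obtain ⟨m, rfl⟩ := mem_colSpace_iff.1 hg
  rw [evalCol_sum, hv]
  funext i
  simp [evalAt, Matrix.mulVec, dotProduct]

theorem colSpace_act_le (f : V →ₗ[k] W) (A : Matrix (Fin a) (Fin a) k)
    (B : Matrix (Fin b) (Fin b) k) (M : LinMat k W a b) :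
    colSpace f (act A B M) ≤ (colSpace f M).map (rowMul A) := by
  rw [colSpace, Submodule.span_le]
  rintro _ ⟨j, rfl⟩
  refine ⟨_, mem_colSpace_iff.2 ⟨B j, rfl⟩, ?_⟩
  ext i v
  simp only [rowMul_apply, act, LinearMap.sum_apply, LinearMap.smul_apply, LinearMap.comp_apply,
    smul_eq_mul, Finset.mul_sum]
  exact Finset.sum_congr rfl fun _ _ => Finset.sum_congr rfl fun _ _ => by ring

theorem colSpace_act (f : V →ₗ[k] W) (A : GL (Fin a) k) (B : GL (Fin b) k) (M : LinMat k W a b) :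
    colSpace f (act A.val B.val M) = (colSpace f M).map (rowMul A.val) := by
  refine le_antisymm (colSpace_act_le f _ _ M) ?_
  have h := colSpace_act_le f (A⁻¹).val (B⁻¹).val (act A.val B.val M)
  rw [act_act, ← Units.val_mul, ← Units.val_mul, inv_mul_cancel, inv_mul_cancel, Units.val_one,
    Units.val_one, act_one] at h
  refine (Submodule.map_mono h).trans (le_of_eq ?_)
  rw [← map_rowMul_mul, mul_inv_cancel, map_rowMul_one]

theorem exists_span_range_eq {E : Type*} [AddCommGroup E] [Module k E] (C : Submodule k E)
    [FiniteDimensional k C] (hb : Module.finrank k C = b) :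
    ∃ e : Fin b → E, Submodule.span k (Set.range e) = C := by
  let e := Module.finBasisOfFinrankEq k C hb
  refine ⟨C.subtype ∘ e, ?_⟩
  rw [Set.range_comp, Submodule.span_image, e.span_eq, Submodule.map_top, Submodule.range_subtype]

theorem finrank_span_range_eq_iff {E : Type*} [AddCommGroup E] [Module k E] (e : Fin b → E) :
    Module.finrank k (Submodule.span k (Set.range e)) = b ↔
      ∀ m : Fin b → k, ∑ j, m j • e j = 0 → m = 0 := by
  have h1 := linearIndependent_iff_card_eq_finrank_span (R := k) (b := e)
  rw [Fintype.card_fin, Set.finrank, eq_comm] at h1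
  rw [← h1, Fintype.linearIndependent_iff]
  exact forall_congr' fun m => imp_congr_right fun _ => funext_iff.symm

theorem finrank_colSpace_iff {f : V →ₗ[k] W} {M : LinMat k W a b} :
    Module.finrank k (colSpace f M) = b ↔
      ∀ m : Fin b → k, (fun i => ∑ j, m j • (M i j).comp f : Fin a → Module.Dual k V) = 0 →
        m = 0 := by
  refine (finrank_span_range_eq_iff _).trans (forall_congr' fun m => ?_)
  refine imp_congr_left (Eq.congr (funext fun i => ?_) rfl)
  simp [Finset.sum_apply]

/-- Linear matrices with independent columns and the same column space differ by an invertible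
column operation. -/
theorem equiv_of_colSpace_eq {f : V →ₗ[k] W} (hf : Function.Surjective f) {M M' : LinMat k W a b}
    (hM : Module.finrank k (colSpace f M) = b) (h : colSpace f M' = colSpace f M) :
    M ≈ M' := by
  have hM' : Module.finrank k (colSpace f M') = b := by rw [h, hM]
  have key : ∀ {N N' : LinMat k W a b}, colSpace f N' = colSpace f N →
      ∃ B : Matrix (Fin b) (Fin b) k, N' = act 1 B N := by
    intro N N' hN
    have hmem : ∀ j, (fun i => (N' i j).comp f) ∈ colSpace f N := fun j => by
      rw [← hN]
      exact Submodule.subset_span ⟨j, rfl⟩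
    choose B hB using fun j => mem_colSpace_iff.1 (hmem j)
    refine ⟨B, ?_⟩
    ext i j w
    obtain ⟨v, rfl⟩ := hf w
    have := LinearMap.congr_fun (congrFun (hB j) i) v
    simp only [LinearMap.comp_apply, LinearMap.sum_apply, LinearMap.smul_apply] at this
    simp [act, Matrix.one_apply, this]
  obtain ⟨B, hB⟩ := key h
  obtain ⟨B', hB'⟩ := key h.symm
  have hBB : B * B' = 1 := by
    have h1 : M' = act 1 (B * B') M' := by
      conv_lhs => rw [hB, hB', act_act, one_mul]
    have hsub : ∀ j, (B * B') j = (1 : Matrix (Fin b) (Fin b) k) j := by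
      intro j
      rw [← sub_eq_zero]
      refine finrank_colSpace_iff.1 hM' _ ?_
      ext i v
      have h2 := LinearMap.congr_fun (congrFun (congrFun h1 i) j) (f v)
      simp only [act, Matrix.one_apply, LinearMap.sum_apply, LinearMap.smul_apply, ite_mul,
        one_mul, zero_mul, ite_smul, zero_smul, Finset.sum_ite_irrel, Finset.sum_const_zero,
        smul_eq_mul, Finset.sum_ite_eq, Finset.mem_univ, if_true] at h2
      simp [sub_mul, Finset.sum_sub_distrib, Matrix.one_apply, h2]
    exact funext hsub
  exact ⟨1, ⟨B, B', hBB, mul_eq_one_comm.1 hBB⟩, by simpa using hB⟩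

/-- Classes of linear matrices with independent columns are spaces of columns modulo row
operations. -/
theorem equiv_iff_colSpace {f : V →ₗ[k] W} (hf : Function.Surjective f) {M M' : LinMat k W a b}
    (hM : Module.finrank k (colSpace f M) = b) :
    M ≈ M' ↔ ∃ A : GL (Fin a) k, colSpace f M' = (colSpace f M).map (rowMul A.val) := by
  constructor
  · rintro ⟨A, B, rfl⟩
    exact ⟨A, colSpace_act f A B M⟩
  · rintro ⟨A, hA⟩
    have h1 : M ≈ act A.val (1 : GL (Fin b) k).val M := ⟨A, 1, rfl⟩
    have h2 := colSpace_act f A (1 : GL (Fin b) k) M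
    refine Setoid.trans h1 (equiv_of_colSpace_eq hf ?_ (hA.trans h2.symm))
    rw [h2, ← (Submodule.equivMapOfInjective _ (rowMul_injective A) _).finrank_eq, hM]

/-- Every space of columns vanishing on `ker f` is the column space of a matrix on the target. -/
theorem exists_colSpace_eq {f : V →ₗ[k] W} (hf : Function.Surjective f)
    {C : Submodule k (Fin a → Module.Dual k V)} [FiniteDimensional k C]
    (hC : ∀ g ∈ C, ∀ v ∈ LinearMap.ker f, evalCol a v g = 0) (hb : Module.finrank k C = b) :
    ∃ M : LinMat k W a b, colSpace f M = C := by
  obtain ⟨e, he⟩ := exists_span_range_eq C hb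
  choose h hh using fun j => exists_pullCol_eq hf (e j)
    (hC _ (he ▸ Submodule.subset_span ⟨j, rfl⟩))
  refine ⟨fun i j => h j i, ?_⟩
  rw [← he]
  exact congrArg (fun e => Submodule.span k (Set.range e)) (funext hh)

/-- Invertible matrices act transitively on nonzero vectors. -/
theorem exists_GL_mulVec_eq {n : ℕ} {u : Fin (n + 1) → k} (hu : u ≠ 0) :
    ∃ A : GL (Fin (n + 1)) k, A.val.mulVec u = Pi.single 0 1 := by
  have he : (Pi.single 0 1 : Fin (n + 1) → k) ≠ 0 := by simp
  obtain ⟨g, hg⟩ := Submodule.exists_linearEquiv_restrict_eq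
    ((LinearEquiv.toSpanNonzeroSingleton k _ u hu).symm ≪≫ₗ
      LinearEquiv.toSpanNonzeroSingleton k _ _ he)
  have hu' : g u = Pi.single 0 1 := by
    have := hg (LinearEquiv.toSpanNonzeroSingleton k _ u hu 1)
    rw [LinearEquiv.trans_apply, LinearEquiv.symm_apply_apply] at this
    simpa using this.symm
  refine ⟨⟨LinearMap.toMatrix' g.toLinearMap, LinearMap.toMatrix' g.symm.toLinearMap, ?_, ?_⟩, ?_⟩
  · rw [← LinearMap.toMatrix'_comp, LinearEquiv.comp_symm, LinearMap.toMatrix'_id]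
  · rw [← LinearMap.toMatrix'_comp, LinearEquiv.symm_comp, LinearMap.toMatrix'_id]
  · simpa [LinearMap.toMatrix'_mulVec] using hu'

theorem exists_GL_row_eq {n : ℕ} {u : Fin n → k} (hu : u ≠ 0) :
    ∃ (A : GL (Fin n) k) (i : Fin n), A.val i = u := by
  obtain _ | n := n
  · exact absurd (Subsingleton.elim _ _) hu
  obtain ⟨A, hA⟩ := exists_GL_mulVec_eq hu
  have h : (A⁻¹).val.mulVec (Pi.single 0 1) = u := by
    rw [← hA, Matrix.mulVec_mulVec, ← Units.val_mul, inv_mul_cancel, Units.val_one,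
      Matrix.one_mulVec]
  refine ⟨Matrix.GeneralLinearGroup.mkOfDetNeZero (A⁻¹).val.transpose ?_, 0, ?_⟩
  · rw [Matrix.det_transpose]
    exact (Matrix.GeneralLinearGroup.det A⁻¹).ne_zero
  · rw [← h]
    funext i
    simp [Matrix.GeneralLinearGroup.mkOfDetNeZero]

theorem GL_row_ne_zero {n : ℕ} (A : GL (Fin n) k) (i : Fin n) : A.val i ≠ 0 := fun h =>
  (Matrix.GeneralLinearGroup.det A).ne_zero (Matrix.det_eq_zero_of_row_eq_zero i (congrFun h))

/-- `1`-genericity in terms of generalized entries `ℓᵀ M m`. -/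
theorem oneGeneric_iff {M : LinMat k W a b} :
    OneGeneric M ↔ ∀ ℓ : Fin a → k, ℓ ≠ 0 → ∀ m : Fin b → k, m ≠ 0 →
      ∑ s, ∑ t, (ℓ s * m t) • M s t ≠ 0 := by
  constructor
  · intro h ℓ hℓ m hm
    obtain ⟨A, i, rfl⟩ := exists_GL_row_eq hℓ
    obtain ⟨B, j, rfl⟩ := exists_GL_row_eq hm
    exact h A B i j
  · intro h A B i j
    exact h _ (GL_row_ne_zero A i) _ (GL_row_ne_zero B j)

/-- A `1`-generic matrix has independent entries in each row. -/
theorem OneGeneric.le_finrank [FiniteDimensional k W] {M : LinMat k W (a + 1) b}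
    (hM : OneGeneric M) : b ≤ Module.finrank k W := by
  have h : LinearIndependent k (fun j => M 0 j) := by
    refine Fintype.linearIndependent_iff.2 fun m hm => congrFun ?_
    by_contra hne
    refine oneGeneric_iff.1 hM (Pi.single 0 1) (by simp) m hne ?_
    rw [Finset.sum_eq_single 0]
    · simpa using hm
    · intro s _ hs
      simp [hs]
    · simp
  simpa using h.fintype_card_le_finrank

/-- For a matrix of rank at most one at each point of a finite set `Γ`, regularity means that the
points of `Γ` are separated by the columns. -/
theorem isRegularAt_iff {Γ : Set (ℙ k W)} (hΓ : Γ.Finite) {M : LinMat k W a b}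
    (hM : MinorsVanish Γ M) :
    IsRegularAt Γ M ↔ ∀ y ∈ Γ, ∃ m : Fin b → k, (evalAt M y.rep).mulVec m ≠ 0 ∧
      ∀ y' ∈ Γ, y' ≠ y → (evalAt M y'.rep).mulVec m = 0 := by
  classical
  have := hΓ.fintype
  -- `r y` spans the row space of `M(y)`.
  have hr : ∀ y : Γ, ∃ r : (Fin b → k) →ₗ[k] k, ∀ m, (evalAt M y.1.rep).mulVec m = 0 ↔ r m = 0 := by
    intro y
    by_cases h0 : ∃ i j, evalAt M y.1.rep i j ≠ 0
    · obtain ⟨i, j, hij⟩ := h0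
      refine ⟨LinearMap.proj i ∘ₗ (evalAt M y.1.rep).mulVecLin, fun m => ⟨fun h => ?_, fun h => ?_⟩⟩
      · simp [h]
      · funext i'
        have h1 : ∀ t, evalAt M y.1.rep i j * evalAt M y.1.rep i' t =
            evalAt M y.1.rep i' j * evalAt M y.1.rep i t := fun t => by
          have := hM y.1 y.2 i i' j t
          rw [sub_eq_zero] at this
          exact this.trans (mul_comm _ _)
        have h2 : evalAt M y.1.rep i j * (evalAt M y.1.rep).mulVec m i' =
            evalAt M y.1.rep i' j * (evalAt M y.1.rep).mulVec m i := by
          simp only [Matrix.mulVec, dotProduct, Finset.mul_sum, ← mul_assoc, h1]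
        have h3 : (evalAt M y.1.rep).mulVec m i = 0 := h
        rw [h3, mul_zero] at h2
        exact (mul_eq_zero.1 h2).resolve_left hij
    · push Not at h0
      refine ⟨0, fun m => ⟨fun _ => rfl, fun _ => ?_⟩⟩
      funext i
      simp [Matrix.mulVec, dotProduct, h0]
  choose r hr using hr
  let R : (Fin b → k) →ₗ[k] (Γ → k) := LinearMap.pi r
  have hker : ⨅ z ∈ Γ, LinearMap.ker (evalAt M z.rep).mulVecLin = LinearMap.ker R := by
    ext m
    simp only [Submodule.mem_iInf, LinearMap.mem_ker, Matrix.mulVecLin_apply]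
    constructor
    · intro h
      funext y
      exact (hr y m).1 (h y.1 y.2)
    · intro h y hy
      exact (hr ⟨y, hy⟩ m).2 (congrFun h ⟨y, hy⟩)
  have hcard : Module.finrank k (Γ → k) = Γ.ncard := by
    rw [Module.finrank_fintype_fun_eq_card, ← Nat.card_eq_fintype_card, Nat.card_coe_set_eq]
  rw [IsRegularAt, hker, R.quotKerEquivRange.finrank_eq, ← hcard]
  have htop : Module.finrank k (LinearMap.range R) = Module.finrank k (Γ → k) ↔
      LinearMap.range R = ⊤ :=
    ⟨Submodule.eq_top_of_finrank_eq, fun h => by rw [h, finrank_top]⟩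
  rw [htop]
  constructor
  · intro h y hy
    obtain ⟨m, hm⟩ := LinearMap.range_eq_top.1 h (Pi.single ⟨y, hy⟩ 1)
    have hm' : ∀ y', r y' m = (Pi.single ⟨y, hy⟩ 1 : Γ → k) y' := congrFun hm
    refine ⟨m, fun h0 => ?_, fun y' hy' hne => ?_⟩
    · have := (hr ⟨y, hy⟩ m).1 h0
      simp [hm'] at this
    · refine (hr ⟨y', hy'⟩ m).2 ?_
      rw [hm', Pi.single_eq_of_ne]
      exact fun h => hne (congrArg Subtype.val h)
  · intro h
    rw [eq_top_iff, ← (Pi.basisFun k Γ).span_eq, Submodule.span_le]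
    rintro _ ⟨y, rfl⟩
    obtain ⟨m, hm, hm'⟩ := h y.1 y.2
    have hne : r y m ≠ 0 := fun h0 => hm ((hr y m).2 h0)
    refine ⟨(r y m)⁻¹ • m, ?_⟩
    funext y'
    by_cases hy : y' = y
    · subst hy
      simp [R, hne]
    · have : r y' m = 0 := (hr y' m).1 (hm' y'.1 y'.2 fun h => hy (Subtype.ext h))
      simp [R, this, hy]

end ColumnSpaces

/-! ### Spaces of columns of scroll matrices -/

section ScrollSpaces

variable {k : Type*} [Field k] {V W W' : Type*} [AddCommGroup V] [Module k V]
  [AddCommGroup W] [Module k W] [AddCommGroup W'] [Module k W'] {a b b' : ℕ}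

/-- The column spaces, pulled back to `V`, of the `Γ`-regular scroll matrices of the projection of
`X` from `Λ`. Regularity is encoded as the existence of columns separating the points of `Γ`. Two
points `y`, `y'` outside `Λ` have distinct projections when `y'` does not lie in `Λ + ⟨y⟩`. -/
structure IsScrollSpace (X Γ : Set (ℙ k V)) (Λ : Submodule k V)
    (C : Submodule k (Fin a → Module.Dual k V)) : Prop where
  vanish : ∀ g ∈ C, ∀ v ∈ Λ, evalCol a v g = 0
  oneGeneric : ∀ g ∈ C, g ≠ 0 → ∀ ℓ : Fin a → k, ℓ ≠ 0 → ∑ i, ℓ i • g i ≠ 0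
  rank_le_one : ∀ x ∈ X, ∀ g ∈ C, ∀ h ∈ C, evalCol a x.rep g ≠ 0 →
    ∃ t : k, evalCol a x.rep h = t • evalCol a x.rep g
  separates : ∀ y ∈ Γ, y.rep ∉ Λ → ∃ g ∈ C, evalCol a y.rep g ≠ 0 ∧
    ∀ y' ∈ Γ, y'.rep ∉ Λ ⊔ Submodule.span k {y.rep} → evalCol a y'.rep g = 0

/-- The image of a set of points under the linear projection `f`, where it is defined. -/
def projImage (f : V →ₗ[k] W) (Y : Set (ℙ k V)) : Set (ℙ k W) :=
  {y | ∃ x ∈ Y, ∃ h : f x.rep ≠ 0, y = Projectivization.mk k (f x.rep) h}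

theorem projImage_id (Y : Set (ℙ k V)) : projImage LinearMap.id Y = Y := by
  ext y
  constructor
  · rintro ⟨x, hx, h, rfl⟩
    simpa using hx
  · intro hy
    exact ⟨y, hy, y.rep_nonzero, (y.mk_rep).symm⟩

theorem projImage_finite (f : V →ₗ[k] W) {Y : Set (ℙ k V)} (hY : Y.Finite) :
    (projImage f Y).Finite := by
  classical
  refine (hY.image fun x => if h : f x.rep ≠ 0 then some (Projectivization.mk k (f x.rep) h)
    else none).preimage (Option.some_injective _).injOn |>.subset ?_
  rintro _ ⟨x, hx, h, rfl⟩
  exact ⟨x, hx, dif_pos h⟩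

theorem minorsVanish_projImage_iff (f : V →ₗ[k] W) (Y : Set (ℙ k V)) (M : LinMat k W a b) :
    MinorsVanish (projImage f Y) M ↔ MinorsVanish Y (fun i j => (M i j).comp f) := by
  constructor
  · intro h x hx i i' j j'
    by_cases h0 : f x.rep = 0
    · simp [h0]
    · have h1 := h _ ⟨x, hx, h0, rfl⟩ i i' j j'
      obtain ⟨c, hc⟩ := Projectivization.exists_smul_eq_mk_rep k (f x.rep) h0
      rw [← hc] at h1
      simp only [Units.smul_def, map_smul, smul_eq_mul] at h1
      have h2 : (c : k) * c * (M i j (f x.rep) * M i' j' (f x.rep) -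
          M i j' (f x.rep) * M i' j (f x.rep)) = 0 := by
        rw [← h1]
        ring
      exact (mul_eq_zero.1 h2).resolve_left (mul_ne_zero c.ne_zero c.ne_zero)
  · rintro h _ ⟨x, hx, h0, rfl⟩ i i' j j'
    obtain ⟨c, hc⟩ := Projectivization.exists_smul_eq_mk_rep k (f x.rep) h0
    rw [← hc]
    have h1 := h x hx i i' j j'
    simp only [LinearMap.comp_apply] at h1
    simp only [Units.smul_def, map_smul, smul_eq_mul]
    linear_combination (c : k) * c * h1

theorem minorsVanish_projVariety_iff (Λ : Submodule k V) (X : Set (ℙ k V))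
    (M : LinMat k (V ⧸ Λ) a b) :
    MinorsVanish (projVariety Λ X) M ↔ MinorsVanish X (fun i j => (M i j).comp Λ.mkQ) := by
  let _ := zariski k (V ⧸ Λ)
  rw [← minorsVanish_projImage_iff]
  refine ⟨fun h x hx => h x (subset_closure hx), fun h x hx i i' j j' => ?_⟩
  by_contra hne
  obtain ⟨y, hy, hyY⟩ := mem_closure_iff.1 hx _
    (isOpen_minor_ne_zero (M i j) (M i' j') (M i j') (M i' j)) hne
  exact hy (h y hyY i i' j j')

theorem oneGeneric_iff_colSpace {f : V →ₗ[k] W} (hf : Function.Surjective f)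
    {M : LinMat k W (a + 1) b} :
    OneGeneric M ↔ Module.finrank k (colSpace f M) = b ∧
      ∀ g ∈ colSpace f M, g ≠ 0 → ∀ ℓ : Fin (a + 1) → k, ℓ ≠ 0 → ∑ i, ℓ i • g i ≠ 0 := by
  have hsum : ∀ (ℓ : Fin (a + 1) → k) (m : Fin b → k),
      (∑ s, ∑ t, (ℓ s * m t) • M s t).comp f = ∑ i, ℓ i • ∑ j, m j • (M i j).comp f := by
    intro ℓ m
    ext v
    simp [Finset.mul_sum, mul_assoc]
  have hzero : ∀ φ : Module.Dual k W, φ.comp f = 0 ↔ φ = 0 := fun φ =>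
    ⟨fun h => (LinearMap.cancel_right hf).1 (h.trans (LinearMap.zero_comp f).symm),
      fun h => by rw [h, LinearMap.zero_comp]⟩
  rw [oneGeneric_iff, finrank_colSpace_iff (f := f)]
  constructor
  · intro h
    constructor
    · intro m hm
      by_contra hne
      refine h (Pi.single 0 1) (by simp) m hne ((hzero _).1 ?_)
      rw [hsum]
      exact Finset.sum_eq_zero fun i _ => by rw [congrFun hm i, Pi.zero_apply, smul_zero]
    · intro g hg hg0 ℓ hℓ h0
      obtain ⟨m, rfl⟩ := mem_colSpace_iff.1 hg
      have hm : m ≠ 0 := by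
        rintro rfl
        exact hg0 (funext fun i => by simp)
      exact h ℓ hℓ m hm ((hzero _).1 (by rw [hsum, h0]))
  · rintro ⟨h1, h2⟩ ℓ hℓ m hm h0
    refine h2 _ (mem_colSpace_iff.2 ⟨m, rfl⟩) (fun h => hm (h1 m h)) ℓ hℓ ?_
    rw [← hsum, h0, LinearMap.zero_comp]

theorem minorsVanish_iff_colSpace {f : V →ₗ[k] W} {X : Set (ℙ k V)} {M : LinMat k W a b} :
    MinorsVanish X (fun i j => (M i j).comp f) ↔
      ∀ x ∈ X, ∀ g ∈ colSpace f M, ∀ h ∈ colSpace f M, evalCol a x.rep g ≠ 0 →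
        ∃ t : k, evalCol a x.rep h = t • evalCol a x.rep g := by
  constructor
  · intro hM x hx g hg h hh hne
    obtain ⟨m, rfl⟩ := mem_colSpace_iff.1 hg
    obtain ⟨m', rfl⟩ := mem_colSpace_iff.1 hh
    rw [evalCol_sum, evalCol_sum] at *
    set N := evalAt M (f x.rep) with hN
    have hminor : ∀ i i' j j', N i j * N i' j' = N i j' * N i' j := fun i i' j j' =>
      sub_eq_zero.1 (hM x hx i i' j j')
    obtain ⟨i, hi⟩ := Function.ne_iff.1 hne
    refine ⟨N.mulVec m' i / N.mulVec m i, funext fun i' => ?_⟩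
    rw [Pi.smul_apply, smul_eq_mul, div_mul_eq_mul_div, eq_div_iff hi]
    simp only [Matrix.mulVec, dotProduct, Finset.sum_mul_sum]
    refine Finset.sum_congr rfl fun j _ => Finset.sum_congr rfl fun j' _ => ?_
    linear_combination m' j * m j' * hminor i' i j j'
  · intro h x hx i i' j j'
    have hc : ∀ j, (fun i => (M i j).comp f) ∈ colSpace f M := fun j =>
      Submodule.subset_span ⟨j, rfl⟩
    by_cases h0 : evalCol a x.rep (fun i => (M i j).comp f) = 0
    · have h1 : ∀ i, M i j (f x.rep) = 0 := congrFun h0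
      simp [h1]
    · obtain ⟨t, ht⟩ := h x hx _ (hc j) _ (hc j') h0
      have h1 : ∀ i, M i j' (f x.rep) = t * M i j (f x.rep) := congrFun ht
      simp only [LinearMap.comp_apply, h1]
      ring

theorem rep_notMem_span {x y : ℙ k V} (h : x ≠ y) : x.rep ∉ Submodule.span k {y.rep} := by
  intro hx
  obtain ⟨t, ht⟩ := Submodule.mem_span_singleton.1 hx
  rw [← x.mk_rep, ← y.mk_rep] at h
  exact h ((Projectivization.mk_eq_mk_iff' k _ _ _ _).2 ⟨t, ht⟩)

theorem mem_ker_sup_span_iff (f : V →ₗ[k] W) (u v : V) :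
    u ∈ LinearMap.ker f ⊔ Submodule.span k {v} ↔ ∃ t : k, t • f v = f u := by
  rw [Submodule.mem_sup]
  constructor
  · rintro ⟨x, hx, y, hy, rfl⟩
    obtain ⟨t, rfl⟩ := Submodule.mem_span_singleton.1 hy
    exact ⟨t, by rw [map_add, LinearMap.mem_ker.1 hx, zero_add, map_smul]⟩
  · rintro ⟨t, ht⟩
    refine ⟨u - t • v, ?_, t • v, Submodule.smul_mem _ _ (Submodule.mem_span_singleton_self v),
      sub_add_cancel _ _⟩
    rw [LinearMap.mem_ker, map_sub, map_smul, ht, sub_self]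

/-- Scroll matrices of a projection, in terms of their column spaces. -/
theorem isScroll_iff_colSpace {f : V →ₗ[k] W} (hf : Function.Surjective f) {X Γ : Set (ℙ k V)}
    (hΓX : Γ ⊆ X) (hΓ : Γ.Finite) {X' : Set (ℙ k W)} {M : LinMat k W (a + 1) b}
    (hX' : MinorsVanish X' M ↔ MinorsVanish X (fun i j => (M i j).comp f)) :
    ((OneGeneric M ∧ MinorsVanish X' M) ∧ IsRegularAt (projImage f Γ) M) ↔
      Module.finrank k (colSpace f M) = b ∧
        IsScrollSpace X Γ (LinearMap.ker f) (colSpace f M) := by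
  have hreg : MinorsVanish X (fun i j => (M i j).comp f) →
      (IsRegularAt (projImage f Γ) M ↔
        ∀ y ∈ Γ, y.rep ∉ LinearMap.ker f → ∃ g ∈ colSpace f M, evalCol (a + 1) y.rep g ≠ 0 ∧
          ∀ y' ∈ Γ, y'.rep ∉ LinearMap.ker f ⊔ Submodule.span k {y.rep} →
            evalCol (a + 1) y'.rep g = 0) := by
    intro hM
    have hM' : MinorsVanish (projImage f Γ) M := (minorsVanish_projImage_iff f Γ M).2
      fun x hx => hM x (hΓX hx)
    rw [isRegularAt_iff (projImage_finite f hΓ) hM']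
    have hrep : ∀ (x : ℙ k V) (h : f x.rep ≠ 0) (m : Fin b → k),
        (evalAt M (Projectivization.mk k (f x.rep) h).rep).mulVec m = 0 ↔
          evalCol (a + 1) x.rep (fun i => ∑ j, m j • (M i j).comp f) = 0 := by
      intro x h m
      obtain ⟨c, hc⟩ := Projectivization.exists_smul_eq_mk_rep k (f x.rep) h
      have h1 : evalAt M ((c : k) • f x.rep) = (c : k) • evalAt M (f x.rep) := by
        ext i j
        simp [evalAt]
      rw [← hc, evalCol_sum, Units.smul_def, h1, Matrix.smul_mulVec, smul_eq_zero]
      simp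
    have hmk : ∀ (x y : ℙ k V) (hx : f x.rep ≠ 0) (hy : f y.rep ≠ 0),
        Projectivization.mk k (f x.rep) hx = Projectivization.mk k (f y.rep) hy ↔
          x.rep ∈ LinearMap.ker f ⊔ Submodule.span k {y.rep} := fun x y hx hy => by
      rw [Projectivization.mk_eq_mk_iff', mem_ker_sup_span_iff]
    constructor
    · intro h y hy hy0
      obtain ⟨m, hm, hm'⟩ := h _ ⟨y, hy, hy0, rfl⟩
      refine ⟨_, mem_colSpace_iff.2 ⟨m, rfl⟩, fun h0 => hm ((hrep y hy0 m).2 h0),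
        fun y' hy' hne => ?_⟩
      have hy0' : f y'.rep ≠ 0 := fun h0 => hne (Submodule.mem_sup_left h0)
      exact (hrep y' hy0' m).1 (hm' _ ⟨y', hy', hy0', rfl⟩ fun h0 => hne ((hmk _ _ _ _).1 h0))
    · rintro h _ ⟨y, hy, hy0, rfl⟩
      obtain ⟨g, hg, hgy, hg'⟩ := h y hy hy0
      obtain ⟨m, rfl⟩ := mem_colSpace_iff.1 hg
      refine ⟨m, fun h0 => hgy ((hrep y hy0 m).1 h0), ?_⟩
      rintro _ ⟨y', hy', hy0', rfl⟩ hne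
      exact (hrep y' hy0' m).2 (hg' y' hy' fun h0 => hne ((hmk _ _ _ _).2 h0))
  rw [hX']
  constructor
  · rintro ⟨⟨h1, h2⟩, h3⟩
    obtain ⟨h4, h5⟩ := (oneGeneric_iff_colSpace hf).1 h1
    exact ⟨h4, fun g hg v hv => colSpace_vanish hg hv, h5, minorsVanish_iff_colSpace.1 h2,
      (hreg h2).1 h3⟩
  · rintro ⟨h1, h2⟩
    have h3 := minorsVanish_iff_colSpace.2 h2.rank_le_one
    exact ⟨⟨(oneGeneric_iff_colSpace hf).2 ⟨h1, h2.oneGeneric⟩, h3⟩, (hreg h3).2 h2.separates⟩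

/-- Deleting the column that does not vanish at `v` cuts the column space down to the columns
vanishing at `v`. -/
theorem innerProj_eq_of_colSpace [FiniteDimensional k V] {f : V →ₗ[k] W}
    (hf : Function.Surjective f) {g : W →ₗ[k] W'} (hg : Function.Surjective g) {v : V}
    (hv : g (f v) = 0) (hb : b = b' + 1) {M : LinMat k W (a + 1) b} {N : LinMat k W' (a + 1) b'}
    (hM : Module.finrank k (colSpace f M) = b)
    (hN : Module.finrank k (colSpace (g ∘ₗ f) N) = b')
    (hC : colSpace (g ∘ₗ f) N = colSpace f M ⊓ LinearMap.ker (evalCol (a + 1) v))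
    {h : Fin (a + 1) → Module.Dual k V} (hh : h ∈ colSpace f M)
    (hhv : evalCol (a + 1) v h ≠ 0) : innerProj g (f v) hb ⟦M⟧ = ⟦N⟧ := by
  subst hb
  obtain ⟨c, rfl⟩ := exists_pullCol_eq hf h fun u hu => colSpace_vanish hh hu
  let M₀ : LinMat k W (a + 1) (b' + 1) := fun i => Fin.cons (c i) fun j => (N i j).comp g
  have hNle : colSpace (g ∘ₗ f) N ≤ colSpace f M := hC ▸ inf_le_left
  have hNv : ∀ m : Fin b' → k,
      evalCol (a + 1) v (fun i => ∑ j, m j • (N i j).comp (g ∘ₗ f)) = 0 := fun m => by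
    have : (fun i => ∑ j, m j • (N i j).comp (g ∘ₗ f)) ∈ colSpace (g ∘ₗ f) N :=
      mem_colSpace_iff.2 ⟨m, rfl⟩
    rw [hC] at this
    exact this.2
  have hM₀ : Module.finrank k (colSpace f M₀) = b' + 1 := by
    rw [finrank_colSpace_iff]
    intro m hm
    have hsplit : (fun i => ∑ j, m j • (M₀ i j).comp f) = m 0 • pullCol (a + 1) f c +
        fun i => ∑ j : Fin b', m j.succ • (N i j).comp (g ∘ₗ f) := by
      funext i
      rw [Fin.sum_univ_succ]
      rfl
    rw [hsplit] at hm
    have h0 := congrArg (evalCol (a + 1) v) hm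
    rw [map_add, map_smul, hNv, add_zero, map_zero, smul_eq_zero] at h0
    have hm0 : m 0 = 0 := h0.resolve_right hhv
    rw [hm0, zero_smul, zero_add] at hm
    have hm1 := finrank_colSpace_iff.1 hN (fun j => m j.succ) hm
    funext j
    exact Fin.cases hm0 (fun j => congrFun hm1 j) j
  have hle : colSpace f M₀ ≤ colSpace f M := by
    refine Submodule.span_le.2 ?_
    rintro _ ⟨j, rfl⟩
    refine Fin.cases hh (fun j => ?_) j
    exact hNle (Submodule.subset_span ⟨j, rfl⟩)
  have heq : M ≈ M₀ := equiv_of_colSpace_eq hf hM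
    (Submodule.eq_of_le_of_finrank_eq hle (hM₀.trans hM.symm))
  rw [Quotient.sound heq]
  obtain ⟨A, hA⟩ := exists_GL_mulVec_eq hhv
  have hdel : DeletesColumn g (f v) rfl M₀ (act A.val (1 : GL (Fin b') k).val N) := by
    refine ⟨A, 1, fun i j => ?_, fun i j => ?_⟩
    · have hval : evalAt (act A.val (1 : GL (Fin (b' + 1)) k).val M₀) (f v) i j =
          ∑ s, A.val i s * M₀ s j (f v) := by
        simp [evalAt, act, Matrix.one_apply]
      rw [hval]
      refine Fin.cases ?_ (fun j => ?_) j
      · have h1 : ∑ s, A.val i s * M₀ s 0 (f v) = (Pi.single 0 1 : Fin (a + 1) → k) i := by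
          rw [← hA]
          rfl
        rw [h1]
        by_cases hi : i = 0
        · simp [hi]
        · simp [hi, Fin.val_eq_zero_iff]
      · have h1 : ∀ s, M₀ s j.succ (f v) = 0 := fun s => by
          simp [M₀, hv]
        simp [h1]
    · ext w
      have : (⟨j.val + 1, by omega⟩ : Fin (b' + 1)) = j.succ := rfl
      simp [act, Matrix.one_apply, this, M₀]
  rw [innerProj_mk g hg (f v) rfl hdel]
  exact Quotient.sound (Setoid.symm ⟨A, 1, rfl⟩)

theorem finrank_inf_ker_add_one {E F : Type*} [AddCommGroup E] [Module k E] [AddCommGroup F]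
    [Module k F] (C : Submodule k E) [FiniteDimensional k C] (L : E →ₗ[k] F) {g : E} (hg : g ∈ C)
    (hLg : L g ≠ 0) (h : ∀ e ∈ C, ∃ t : k, L e = t • L g) :
    Module.finrank k (C ⊓ LinearMap.ker L : Submodule k E) + 1 = Module.finrank k C := by
  have h1 := LinearMap.finrank_range_add_finrank_ker (L.domRestrict C)
  have h2 : LinearMap.range (L.domRestrict C) = Submodule.span k {L g} := by
    apply le_antisymm
    · rintro _ ⟨⟨e, he⟩, rfl⟩
      obtain ⟨t, ht⟩ := h e he
      exact Submodule.mem_span_singleton.2 ⟨t, ht.symm⟩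
    · rw [Submodule.span_singleton_le_iff_mem]
      exact ⟨⟨g, hg⟩, rfl⟩
  have h3 : Module.finrank k (LinearMap.ker (L.domRestrict C)) =
      Module.finrank k (C ⊓ LinearMap.ker L : Submodule k E) := by
    rw [← Submodule.map_comap_subtype, Submodule.finrank_map_subtype_eq]
    rfl
  rw [h2, finrank_span_singleton hLg, h3] at h1
  omega

namespace IsScrollSpace

variable {X Γ : Set (ℙ k V)} {Λ : Submodule k V} {C : Submodule k (Fin a → Module.Dual k V)}

theorem finrank_inf_ker [FiniteDimensional k V] (h : IsScrollSpace X Γ Λ C) (hΓX : Γ ⊆ X)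
    {z : ℙ k V} (hz : z ∈ Γ) (hzΛ : z.rep ∉ Λ) :
    Module.finrank k (C ⊓ LinearMap.ker (evalCol a z.rep) : Submodule k _) + 1 =
      Module.finrank k C := by
  obtain ⟨g, hg, hgz, -⟩ := h.separates z hz hzΛ
  exact finrank_inf_ker_add_one C _ hg hgz fun e he => h.rank_le_one z (hΓX hz) g hg e he hgz

/-- Projecting a scroll space from a point of `Γ`. -/
theorem inf_ker (h : IsScrollSpace X Γ Λ C) {z : ℙ k V} (hz : z ∈ Γ) (hzΛ : z.rep ∉ Λ) :
    IsScrollSpace X Γ (Λ ⊔ Submodule.span k {z.rep}) (C ⊓ LinearMap.ker (evalCol a z.rep)) where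
  vanish g hg v hv := by
    obtain ⟨x, hx, y, hy, rfl⟩ := Submodule.mem_sup.1 hv
    obtain ⟨t, rfl⟩ := Submodule.mem_span_singleton.1 hy
    have h1 : evalCol a x g = 0 := h.vanish g hg.1 x hx
    have h2 : evalCol a z.rep g = 0 := hg.2
    funext i
    have h3 : g i x = 0 := congrFun h1 i
    have h4 : g i z.rep = 0 := congrFun h2 i
    simp [h3, h4]
  oneGeneric g hg := h.oneGeneric g hg.1
  rank_le_one x hx g hg g' hg' := h.rank_le_one x hx g hg.1 g' hg'.1
  separates y hy hyΛ := by
    obtain ⟨g, hg, hgy, hg'⟩ := h.separates y hy fun h => hyΛ (Submodule.mem_sup_left h)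
    have hz' : z.rep ∉ Λ ⊔ Submodule.span k {y.rep} := by
      intro h1
      obtain ⟨x, hx, v, hv, hxv⟩ := Submodule.mem_sup.1 h1
      obtain ⟨t, rfl⟩ := Submodule.mem_span_singleton.1 hv
      have ht : t ≠ 0 := by
        rintro rfl
        rw [zero_smul, add_zero] at hxv
        exact hzΛ (hxv ▸ hx)
      refine hyΛ ?_
      have h2 : y.rep = (-t⁻¹) • x + t⁻¹ • z.rep := by
        rw [← hxv, smul_add, smul_smul, inv_mul_cancel₀ ht, one_smul, neg_smul,
          neg_add_cancel_left]
      rw [h2]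
      exact Submodule.add_mem_sup (Λ.smul_mem _ hx)
        (Submodule.smul_mem _ _ (Submodule.mem_span_singleton_self _))
    refine ⟨g, ⟨hg, hg' z hz hz'⟩, hgy, fun y' hy' hne => hg' y' hy' fun h1 => hne ?_⟩
    have hle : Λ ⊔ Submodule.span k {y.rep} ≤
        Λ ⊔ Submodule.span k {z.rep} ⊔ Submodule.span k {y.rep} :=
      sup_le_sup_right le_sup_left _
    exact hle h1

theorem map_rowMul (h : IsScrollSpace X Γ Λ C) (A : GL (Fin a) k) :
    IsScrollSpace X Γ Λ (C.map (rowMul A.val)) where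
  vanish := by
    rintro _ ⟨g, hg, rfl⟩ v hv
    rw [evalCol_rowMul, h.vanish g hg v hv, Matrix.mulVec_zero]
  oneGeneric := by
    rintro _ ⟨g, hg, rfl⟩ hne ℓ hℓ h0
    have hg0 : g ≠ 0 := by
      rintro rfl
      exact hne (map_zero _)
    refine h.oneGeneric g hg hg0 (Matrix.vecMul ℓ A.val) (fun h1 => hℓ ?_) ?_
    · have := congrArg (fun u => Matrix.vecMul u (A⁻¹).val) h1
      simpa [Matrix.vecMul_vecMul, ← Units.val_mul] using this
    · rw [← h0]
      ext v
      simp only [rowMul_apply, Matrix.vecMul, dotProduct, LinearMap.sum_apply,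
        LinearMap.smul_apply, smul_eq_mul, Finset.sum_mul, Finset.mul_sum, mul_assoc]
      exact Finset.sum_comm
  rank_le_one := by
    rintro x hx _ ⟨g, hg, rfl⟩ _ ⟨g', hg', rfl⟩ hne
    rw [evalCol_rowMul] at hne
    have hg0 : evalCol a x.rep g ≠ 0 := fun h0 => hne (by rw [h0, Matrix.mulVec_zero])
    obtain ⟨t, ht⟩ := h.rank_le_one x hx g hg g' hg' hg0
    exact ⟨t, by rw [evalCol_rowMul, evalCol_rowMul, ht, Matrix.mulVec_smul]⟩
  separates y hy hyΛ := by
    obtain ⟨g, hg, hgy, hg'⟩ := h.separates y hy hyΛ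
    refine ⟨_, ⟨g, hg, rfl⟩, fun h0 => hgy ?_, fun y' hy' hne => ?_⟩
    · have := evalCol_rowMul y.rep (A⁻¹).val (rowMul A.val g)
      rw [rowMul_inv_rowMul, h0, Matrix.mulVec_zero] at this
      exact this
    · rw [evalCol_rowMul, hg' y' hy' hne, Matrix.mulVec_zero]

/-- The columns vanishing at `z` and those vanishing at `w` span all columns. -/
theorem le_inf_ker_sup_inf_ker (h : IsScrollSpace X Γ ⊥ C) (hΓX : Γ ⊆ X) {z w : ℙ k V}
    (hz : z ∈ Γ) (hw : w ∈ Γ) (hzw : z ≠ w) :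
    C ≤ (C ⊓ LinearMap.ker (evalCol a z.rep)) ⊔ (C ⊓ LinearMap.ker (evalCol a w.rep)) := by
  intro e he
  obtain ⟨g, hg, hgw, hg'⟩ := h.separates w hw fun h0 => w.rep_nonzero ((Submodule.mem_bot k).1 h0)
  have hgz : evalCol a z.rep g = 0 := hg' z hz (by rw [bot_sup_eq]; exact rep_notMem_span hzw)
  obtain ⟨t, ht⟩ := h.rank_le_one w (hΓX hw) g hg e he hgw
  rw [← add_sub_cancel (t • g) e]
  refine Submodule.add_mem_sup (Submodule.smul_mem _ _ ⟨hg, hgz⟩)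
    ⟨C.sub_mem he (C.smul_mem _ hg), ?_⟩
  exact LinearMap.mem_ker.2 (by rw [map_sub, map_smul, ht, sub_self])

/-- Row operations preserving a nonzero scroll space are scalar. At each point of `X` the values of
the columns span at most a line, which has to be an eigenline; as `X` is irreducible, the
eigenvalue is constant, and `1`-genericity makes it the only one. -/
theorem eq_smul_one_of_stabilizes (h : IsScrollSpace X Γ Λ C)
    (hX : @IsIrreducible _ (zariski k V) X) (hnd : IsNondegenerate X) (hC : C ≠ ⊥)
    {A : Matrix (Fin a) (Fin a) k} (hA : ∀ g ∈ C, rowMul A g ∈ C) : ∃ s : k, A = s • 1 := by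
  obtain ⟨g, hg, hg0⟩ := Submodule.exists_mem_ne_zero_of_ne_bot hC
  obtain ⟨i₀, hi₀⟩ := Function.ne_iff.1 hg0
  by_contra! hne
  have hrow : ∀ s : k, ∃ i, rowMul (A - s • 1) g i ≠ 0 := by
    intro s
    obtain ⟨i, hi⟩ := Function.ne_iff.1 (sub_ne_zero.2 (hne s))
    exact ⟨i, h.oneGeneric g hg hg0 _ hi⟩
  choose i hi using hrow
  let φ : Option (Module.End.Eigenvalues (Matrix.toLin' A)) → Module.Dual k V := fun o =>
    o.elim (g i₀) fun μ => rowMul (A - (μ : k) • 1) g (i μ)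
  obtain ⟨x, hx, hφ⟩ := exists_mem_forms_ne_zero_of_finite hX hnd φ (by
    rintro (_ | μ)
    exacts [hi₀, hi μ])
  have hgx : evalCol a x.rep g ≠ 0 := fun h0 => hφ none (congrFun h0 i₀)
  obtain ⟨t, ht⟩ := h.rank_le_one x hx g hg _ (hA g hg) hgx
  rw [evalCol_rowMul] at ht
  have hev : Module.End.HasEigenvalue (Matrix.toLin' A) t :=
    Module.End.hasEigenvalue_of_hasEigenvector
      ⟨Module.End.mem_eigenspace_iff.2 (by rw [Matrix.toLin'_apply, ht]), hgx⟩
  refine hφ (some ⟨t, hev⟩) ?_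
  have h1 : evalCol a x.rep (rowMul (A - t • 1) g) = 0 := by
    rw [evalCol_rowMul, Matrix.sub_mulVec, ht, Matrix.smul_mulVec, Matrix.one_mulVec, sub_self]
  exact congrFun h1 (i t)

/-- Two scroll spaces of the projections from `z` and from `w`, with the same further projection
from the line `zw`, span a scroll space. At a point where a common column `g` does not vanish, all
columns are multiples of `g`; such points are dense in `X`. -/
theorem sup {z w : ℙ k V} (hzw : z ≠ w) {C₁ C₂ : Submodule k (Fin a → Module.Dual k V)}
    (h₁ : IsScrollSpace X Γ (Submodule.span k {z.rep}) C₁)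
    (h₂ : IsScrollSpace X Γ (Submodule.span k {w.rep}) C₂)
    (hX : @IsIrreducible _ (zariski k V) X) (hnd : IsNondegenerate X)
    (hz : z ∈ Γ) (hw : w ∈ Γ)
    (hΓ : ∀ u ∈ Γ, ∀ y ∈ Γ, ∀ y' ∈ Γ, y ≠ u → y' ≠ u → y' ≠ y →
      y'.rep ∉ Submodule.span k {u.rep} ⊔ Submodule.span k {y.rep})
    {g : Fin a → Module.Dual k V} (hg₁ : g ∈ C₁) (hg₂ : g ∈ C₂) (hg : g ≠ 0) :
    IsScrollSpace X Γ ⊥ (C₁ ⊔ C₂) := by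
  have hmul : ∀ x ∈ X, evalCol a x.rep g ≠ 0 → ∀ h ∈ C₁ ⊔ C₂, ∃ t : k,
      evalCol a x.rep h = t • evalCol a x.rep g := by
    intro x hx hgx h hh
    obtain ⟨u, hu, v, hv, rfl⟩ := Submodule.mem_sup.1 hh
    obtain ⟨s, hs⟩ := h₁.rank_le_one x hx g hg₁ u hu hgx
    obtain ⟨t, ht⟩ := h₂.rank_le_one x hx g hg₂ v hv hgx
    exact ⟨s + t, by rw [map_add, hs, ht, add_smul]⟩
  obtain ⟨i₀, hi₀⟩ := Function.ne_iff.1 hg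
  refine ⟨?_, ?_, ?_, ?_⟩
  · rintro h - v hv
    rw [(Submodule.mem_bot k).1 hv]
    funext i
    simp
  · intro h hh hh0 ℓ hℓ h0
    obtain ⟨i₁, hi₁⟩ := Function.ne_iff.1 hh0
    obtain ⟨x, hx, hφ⟩ := exists_mem_forms_ne_zero_of_finite hX hnd
      ![∑ i, ℓ i • g i, h i₁] (by
        intro j
        fin_cases j
        exacts [h₁.oneGeneric g hg₁ hg ℓ hℓ, hi₁])
    have hφ0 : (∑ i, ℓ i • g i) x.rep ≠ 0 := hφ 0
    have hφ1 : h i₁ x.rep ≠ 0 := hφ 1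
    have hgx : evalCol a x.rep g ≠ 0 := by
      intro h1
      refine hφ0 ?_
      have h2 : ∀ i, g i x.rep = 0 := congrFun h1
      simp [h2]
    obtain ⟨t, ht⟩ := hmul x hx hgx h hh
    have ht' : ∀ i, h i x.rep = t * g i x.rep := congrFun ht
    have h1 := LinearMap.congr_fun h0 x.rep
    simp only [LinearMap.sum_apply, LinearMap.smul_apply, ht', smul_eq_mul,
      LinearMap.zero_apply, mul_left_comm _ t, ← Finset.mul_sum] at h1
    have ht0 : t ≠ 0 := by
      rintro rfl
      exact hφ1 (by rw [ht', zero_mul])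
    refine hφ0 ?_
    simpa using (mul_eq_zero.1 h1).resolve_left ht0
  · intro x hx h hh h' hh' hhx
    have hminor : ∀ i j, h i x.rep * h' j x.rep - h j x.rep * h' i x.rep = 0 := by
      intro i j
      by_contra hne
      obtain ⟨y, hy, hyO, hyg⟩ := exists_mem_forms_ne_zero hX hnd
        (isOpen_minor_ne_zero (h i) (h' j) (h j) (h' i)) ⟨x, hx, hne⟩
        (fun _ : Unit => g i₀) (fun _ => hi₀)
      have hgy : evalCol a y.rep g ≠ 0 := fun h0 => hyg () (congrFun h0 i₀)
      obtain ⟨t, ht⟩ := hmul y hy hgy h hh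
      obtain ⟨t', ht'⟩ := hmul y hy hgy h' hh'
      have e : ∀ i, h i y.rep = t * g i y.rep := congrFun ht
      have e' : ∀ i, h' i y.rep = t' * g i y.rep := congrFun ht'
      refine hyO ?_
      rw [e, e, e', e']
      ring
    obtain ⟨i, hi⟩ := Function.ne_iff.1 hhx
    have hi' : h i x.rep ≠ 0 := hi
    refine ⟨h' i x.rep / h i x.rep, funext fun j => ?_⟩
    have := hminor i j
    simp only [Pi.smul_apply, evalCol_apply, smul_eq_mul]
    field_simp
    linear_combination this
  · intro y hy _
    -- The columns of the projection from `u` separate the points of `Γ` other than `u`.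
    have hsep : ∀ (u : ℙ k V) (D : Submodule k (Fin a → Module.Dual k V)), u ∈ Γ →
        IsScrollSpace X Γ (Submodule.span k {u.rep}) D → D ≤ C₁ ⊔ C₂ → y ≠ u →
        ∃ g ∈ C₁ ⊔ C₂, evalCol a y.rep g ≠ 0 ∧
          ∀ y' ∈ Γ, y'.rep ∉ (⊥ : Submodule k V) ⊔ Submodule.span k {y.rep} →
            evalCol a y'.rep g = 0 := by
      intro u D hu hD hle hyu
      obtain ⟨g, hg, hgy, hg'⟩ := hD.separates y hy (rep_notMem_span hyu)
      refine ⟨g, hle hg, hgy, fun y' hy' hne => ?_⟩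
      by_cases h : y' = u
      · subst h
        exact hD.vanish g hg _ (Submodule.mem_span_singleton_self _)
      · refine hg' y' hy' (hΓ u hu y hy y' hy' hyu h ?_)
        rintro rfl
        exact hne (Submodule.mem_sup_right (Submodule.mem_span_singleton_self _))
    by_cases h : y = z
    · exact hsep w C₂ hw h₂ le_sup_right fun h' => hzw (h.symm.trans h')
    · exact hsep z C₁ hz h₁ le_sup_left h

end IsScrollSpace

end ScrollSpaces

/-! ### Gluing -/

section Gluing

variable {k : Type*} [Field k] {V W W' : Type*} [AddCommGroup V] [Module k V]
  [AddCommGroup W] [Module k W] [AddCommGroup W'] [Module k W'] {a b b' : ℕ}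

/-- The classes of `Γ`-regular `1`-generic `a × b` matrices of rank at most one on `X`; this is
`scrollClasses` with the size of the matrices left free. -/
def scrollSet (a b : ℕ) (X Γ : Set (ℙ k W)) : Set (LinClass k W a b) :=
  {c | ∃ M : LinMat k W a b, ⟦M⟧ = c ∧ (OneGeneric M ∧ MinorsVanish X M) ∧ IsRegularAt Γ M}

theorem mk_mem_scrollSet_iff {f : V →ₗ[k] W} (hf : Function.Surjective f) {X Γ : Set (ℙ k V)}
    (hΓX : Γ ⊆ X) (hΓ : Γ.Finite) {X' : Set (ℙ k W)}
    (hX' : ∀ M : LinMat k W (a + 1) b,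
      MinorsVanish X' M ↔ MinorsVanish X (fun i j => (M i j).comp f))
    (M : LinMat k W (a + 1) b) :
    (⟦M⟧ : LinClass k W (a + 1) b) ∈ scrollSet (a + 1) b X' (projImage f Γ) ↔
      Module.finrank k (colSpace f M) = b ∧
        IsScrollSpace X Γ (LinearMap.ker f) (colSpace f M) := by
  constructor
  · rintro ⟨M', hM', h⟩
    rw [isScroll_iff_colSpace hf hΓX hΓ (hX' M')] at h
    obtain ⟨A, hA⟩ := (equiv_iff_colSpace hf h.1).1 (Quotient.exact hM')
    rw [hA, ← (Submodule.equivMapOfInjective _ (rowMul_injective A) _).finrank_eq]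
    exact ⟨h.1, h.2.map_rowMul A⟩
  · intro h
    exact ⟨M, rfl, (isScroll_iff_colSpace hf hΓX hΓ (hX' M)).2 h⟩

/-- The effect of an inner projection on column spaces. -/
theorem innerProj_mk_eq [FiniteDimensional k V] {f : V →ₗ[k] W} (hf : Function.Surjective f)
    {g : W →ₗ[k] W'} (hg : Function.Surjective g) {X Γ : Set (ℙ k V)} (hΓX : Γ ⊆ X) {z : ℙ k V}
    (hz : z ∈ Γ) (hzf : z.rep ∉ LinearMap.ker f)
    (hker : LinearMap.ker (g ∘ₗ f) = LinearMap.ker f ⊔ Submodule.span k {z.rep})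
    (hb : b = b' + 1) {M : LinMat k W (a + 1) b}
    (hM : Module.finrank k (colSpace f M) = b)
    (hS : IsScrollSpace X Γ (LinearMap.ker f) (colSpace f M)) {N : LinMat k W' (a + 1) b'}
    (hN : colSpace (g ∘ₗ f) N = colSpace f M ⊓ LinearMap.ker (evalCol (a + 1) z.rep)) :
    innerProj g (f z.rep) hb ⟦M⟧ = ⟦N⟧ ∧ Module.finrank k (colSpace (g ∘ₗ f) N) = b' ∧
      IsScrollSpace X Γ (LinearMap.ker (g ∘ₗ f)) (colSpace (g ∘ₗ f) N) := by
  have hdim := hS.finrank_inf_ker hΓX hz hzf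
  rw [← hN, hM, hb, Nat.add_right_cancel_iff] at hdim
  refine ⟨?_, hdim, ?_⟩
  · obtain ⟨h, hh, hhz, -⟩ := hS.separates z hz hzf
    refine innerProj_eq_of_colSpace hf hg ?_ hb hM hdim hN hh hhz
    have : z.rep ∈ LinearMap.ker (g ∘ₗ f) := by
      rw [hker]
      exact Submodule.mem_sup_right (Submodule.mem_span_singleton_self _)
    exact this
  · rw [hker, hN]
    exact hS.inf_ker hz hzf

theorem exists_innerProj_eq [FiniteDimensional k V] {f : V →ₗ[k] W} (hf : Function.Surjective f)
    {g : W →ₗ[k] W'} (hg : Function.Surjective g) {X Γ : Set (ℙ k V)} (hΓX : Γ ⊆ X) {z : ℙ k V}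
    (hz : z ∈ Γ) (hzf : z.rep ∉ LinearMap.ker f)
    (hker : LinearMap.ker (g ∘ₗ f) = LinearMap.ker f ⊔ Submodule.span k {z.rep})
    (hb : b = b' + 1) {M : LinMat k W (a + 1) b}
    (hM : Module.finrank k (colSpace f M) = b)
    (hS : IsScrollSpace X Γ (LinearMap.ker f) (colSpace f M)) :
    ∃ N : LinMat k W' (a + 1) b',
      colSpace (g ∘ₗ f) N = colSpace f M ⊓ LinearMap.ker (evalCol (a + 1) z.rep) ∧
      innerProj g (f z.rep) hb ⟦M⟧ = ⟦N⟧ ∧ Module.finrank k (colSpace (g ∘ₗ f) N) = b' ∧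
      IsScrollSpace X Γ (LinearMap.ker (g ∘ₗ f)) (colSpace (g ∘ₗ f) N) := by
  have hdim := hS.finrank_inf_ker hΓX hz hzf
  rw [hM] at hdim
  obtain ⟨N, hN⟩ := exists_colSpace_eq (b := b') (f := g ∘ₗ f) (hg.comp hf)
    (C := colSpace f M ⊓ LinearMap.ker (evalCol (a + 1) z.rep))
    (by rw [hker]; exact (hS.inf_ker hz hzf).vanish) (by omega)
  exact ⟨N, hN, innerProj_mk_eq hf hg hΓX hz hzf hker hb hM hS hN⟩

theorem mapsTo_innerProj [FiniteDimensional k V] {f : V →ₗ[k] W} (hf : Function.Surjective f)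
    {g : W →ₗ[k] W'} (hg : Function.Surjective g) {X Γ : Set (ℙ k V)} (hΓX : Γ ⊆ X)
    (hΓ : Γ.Finite) {z : ℙ k V}
    (hz : z ∈ Γ) (hzf : z.rep ∉ LinearMap.ker f)
    (hker : LinearMap.ker (g ∘ₗ f) = LinearMap.ker f ⊔ Submodule.span k {z.rep})
    (hb : b = b' + 1) {X₁ : Set (ℙ k W)} {X₂ : Set (ℙ k W')}
    (hX₁ : ∀ M : LinMat k W (a + 1) b,
      MinorsVanish X₁ M ↔ MinorsVanish X (fun i j => (M i j).comp f))
    (hX₂ : ∀ M : LinMat k W' (a + 1) b',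
      MinorsVanish X₂ M ↔ MinorsVanish X (fun i j => (M i j).comp (g ∘ₗ f))) :
    Set.MapsTo (innerProj (a := a + 1) g (f z.rep) hb) (scrollSet (a + 1) b X₁ (projImage f Γ))
      (scrollSet (a + 1) b' X₂ (projImage (g ∘ₗ f) Γ)) := by
  rintro ⟨M⟩ hc
  obtain ⟨hM, hS⟩ := (mk_mem_scrollSet_iff hf hΓX hΓ hX₁ M).1 hc
  obtain ⟨N, -, h1, h2⟩ := exists_innerProj_eq hf hg hΓX hz hzf hker hb hM hS
  have h3 := (mk_mem_scrollSet_iff (f := g ∘ₗ f) (hg.comp hf) hΓX hΓ hX₂ N).2 h2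
  rw [← h1] at h3
  exact h3

/-- Gluing of scroll classes, for abstract projections `f₁` from `z`, `f₂` from `w` and
`g₁ ∘ f₁ = g₂ ∘ f₂` from the line `zw`. -/
theorem bijOn_innerProj [FiniteDimensional k V] {W₁ W₂ W₁₂ : Type*}
    [AddCommGroup W₁] [Module k W₁] [AddCommGroup W₂] [Module k W₂]
    [AddCommGroup W₁₂] [Module k W₁₂]
    {f₁ : V →ₗ[k] W₁} (hf₁ : Function.Surjective f₁)
    {f₂ : V →ₗ[k] W₂} (hf₂ : Function.Surjective f₂)
    {g₁ : W₁ →ₗ[k] W₁₂} (hg₁ : Function.Surjective g₁)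
    {g₂ : W₂ →ₗ[k] W₁₂} (hg₂ : Function.Surjective g₂)
    (hcomm : g₂ ∘ₗ f₂ = g₁ ∘ₗ f₁) {X Γ : Set (ℙ k V)}
    (hX : @IsIrreducible _ (zariski k V) X) (hnd : IsNondegenerate X) (hΓX : Γ ⊆ X)
    (hΓ : Γ.Finite) {z w : ℙ k V} (hz : z ∈ Γ) (hw : w ∈ Γ) (hzw : z ≠ w)
    (hΓcol : ∀ u ∈ Γ, ∀ y ∈ Γ, ∀ y' ∈ Γ, y ≠ u → y' ≠ u → y' ≠ y →
      y'.rep ∉ Submodule.span k {u.rep} ⊔ Submodule.span k {y.rep})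
    (hker₁ : LinearMap.ker f₁ = Submodule.span k {z.rep})
    (hker₂ : LinearMap.ker f₂ = Submodule.span k {w.rep})
    (hker₁₂ : LinearMap.ker (g₁ ∘ₗ f₁) = Submodule.span k {z.rep} ⊔ Submodule.span k {w.rep})
    {c : ℕ} (hc : 0 < c) (hb : b = b' + 1) (hb' : b' = c + 1)
    {X₁ : Set (ℙ k W₁)} {X₂ : Set (ℙ k W₂)}
    (hX₁ : ∀ M : LinMat k W₁ (a + 1) b',
      MinorsVanish X₁ M ↔ MinorsVanish X (fun i j => (M i j).comp f₁))
    (hX₂ : ∀ M : LinMat k W₂ (a + 1) b',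
      MinorsVanish X₂ M ↔ MinorsVanish X (fun i j => (M i j).comp f₂)) :
    Set.BijOn (fun γ : LinClass k V (a + 1) b =>
        (innerProj f₁ z.rep hb γ, innerProj f₂ w.rep hb γ))
      (scrollSet (a + 1) b X Γ)
      {γ | γ.1 ∈ scrollSet (a + 1) b' X₁ (projImage f₁ Γ) ∧
        γ.2 ∈ scrollSet (a + 1) b' X₂ (projImage f₂ Γ) ∧
        innerProj g₁ (f₁ w.rep) hb' γ.1 = innerProj g₂ (f₂ z.rep) hb' γ.2} := by
  have hid : Function.Surjective (LinearMap.id : V →ₗ[k] V) := Function.surjective_id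
  have hS0 : ∀ M : LinMat k V (a + 1) b,
      (⟦M⟧ : LinClass k V (a + 1) b) ∈ scrollSet (a + 1) b X Γ ↔
        Module.finrank k (colSpace LinearMap.id M) = b ∧
          IsScrollSpace X Γ ⊥ (colSpace LinearMap.id M) := by
    intro M
    have := mk_mem_scrollSet_iff (f := LinearMap.id) hid hΓX hΓ (X' := X) (fun _ => Iff.rfl) M
    rwa [projImage_id, LinearMap.ker_id] at this
  have hS1 := mk_mem_scrollSet_iff hf₁ hΓX hΓ hX₁
  have hS2 := mk_mem_scrollSet_iff hf₂ hΓX hΓ hX₂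
  have hrep : ∀ x : ℙ k V, x.rep ∉ LinearMap.ker (LinearMap.id : V →ₗ[k] V) := fun x hx =>
    x.rep_nonzero hx
  have hk1 : LinearMap.ker (f₁ ∘ₗ LinearMap.id) =
      LinearMap.ker LinearMap.id ⊔ Submodule.span k {z.rep} := by
    rw [LinearMap.comp_id, hker₁, LinearMap.ker_id, bot_sup_eq]
  have hk2 : LinearMap.ker (f₂ ∘ₗ LinearMap.id) =
      LinearMap.ker LinearMap.id ⊔ Submodule.span k {w.rep} := by
    rw [LinearMap.comp_id, hker₂, LinearMap.ker_id, bot_sup_eq]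
  have hwf₁ : w.rep ∉ LinearMap.ker f₁ := by
    rw [hker₁]
    exact rep_notMem_span hzw.symm
  have hzf₂ : z.rep ∉ LinearMap.ker f₂ := by
    rw [hker₂]
    exact rep_notMem_span hzw
  have hk12 : LinearMap.ker (g₁ ∘ₗ f₁) = LinearMap.ker f₁ ⊔ Submodule.span k {w.rep} := by
    rw [hker₁₂, hker₁]
  have hk21 : LinearMap.ker (g₂ ∘ₗ f₂) = LinearMap.ker f₂ ⊔ Submodule.span k {z.rep} := by
    rw [hcomm, hker₁₂, hker₂, sup_comm]
  have hP1 := fun (M : LinMat k V (a + 1) b) (h : _ ∧ _) =>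
    exists_innerProj_eq hid hf₁ hΓX hz (hrep z) hk1 hb (M := M) h.1 h.2
  have hP2 := fun (M : LinMat k V (a + 1) b) (h : _ ∧ _) =>
    exists_innerProj_eq hid hf₂ hΓX hw (hrep w) hk2 hb (M := M) h.1 h.2
  simp only [LinearMap.comp_id, LinearMap.ker_id, LinearMap.id_apply] at hP1 hP2
  have hP12 := fun (M : LinMat k W₁ (a + 1) b') (h : _ ∧ _) =>
    exists_innerProj_eq hf₁ hg₁ hΓX hw hwf₁ hk12 hb' (M := M) h.1 h.2
  have hP21 := fun (M : LinMat k W₂ (a + 1) b') (h : _ ∧ _) =>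
    exists_innerProj_eq hf₂ hg₂ hΓX hz hzf₂ hk21 hb' (M := M) h.1 h.2
  refine ⟨?_, ?_, ?_⟩
  · rintro ⟨M⟩ hM
    have hM' := (hS0 M).1 hM
    obtain ⟨N₁, hN₁, h1, h1'⟩ := hP1 M hM'
    obtain ⟨N₂, hN₂, h2, h2'⟩ := hP2 M hM'
    obtain ⟨N, hN, h3, -⟩ := hP12 N₁ h1'
    refine ⟨?_, ?_, ?_⟩
    · change innerProj f₁ z.rep hb ⟦M⟧ ∈ _
      rw [h1]
      exact (hS1 N₁).2 h1'
    · change innerProj f₂ w.rep hb ⟦M⟧ ∈ _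
      rw [h2]
      exact (hS2 N₂).2 h2'
    · change innerProj g₁ (f₁ w.rep) hb' (innerProj f₁ z.rep hb ⟦M⟧) =
        innerProj g₂ (f₂ z.rep) hb' (innerProj f₂ w.rep hb ⟦M⟧)
      rw [h1, h2, h3]
      refine (innerProj_mk_eq hf₂ hg₂ hΓX hz hzf₂ hk21 hb' h2'.1 h2'.2 ?_).1.symm
      rw [hcomm, hN, hN₁, hN₂, inf_right_comm]
  · rintro ⟨M⟩ hM ⟨M'⟩ hM' heq
    have hC := (hS0 M).1 hM
    have hC' := (hS0 M').1 hM'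
    obtain ⟨N₁, hN₁, h1, h1'⟩ := hP1 M hC
    obtain ⟨N₂, hN₂, h2, h2'⟩ := hP2 M hC
    obtain ⟨N₁', hN₁', h3, -⟩ := hP1 M' hC'
    obtain ⟨N₂', hN₂', h4, -⟩ := hP2 M' hC'
    obtain ⟨N, hN, -, hND, hNS⟩ := hP12 N₁ h1'
    have e1 : (⟦N₁⟧ : LinClass k W₁ (a + 1) b') = ⟦N₁'⟧ :=
      h1.symm.trans ((congrArg Prod.fst heq).trans h3)
    have e2 : (⟦N₂⟧ : LinClass k W₂ (a + 1) b') = ⟦N₂'⟧ :=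
      h2.symm.trans ((congrArg Prod.snd heq).trans h4)
    obtain ⟨A, hA⟩ := (equiv_iff_colSpace hf₁ h1'.1).1 (Quotient.exact e1)
    obtain ⟨B, hB⟩ := (equiv_iff_colSpace hf₂ h2'.1).1 (Quotient.exact e2)
    rw [hN₁, hN₁'] at hA
    rw [hN₂, hN₂'] at hB
    rw [hN₁] at hN
    set C := colSpace LinearMap.id M
    set C' := colSpace LinearMap.id M'
    set D := colSpace (g₁ ∘ₗ f₁) N
    -- `A` and `B` agree on the columns vanishing at both points, hence up to a scalar.
    have hAB : D.map (rowMul A.val) = D.map (rowMul B.val) := by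
      conv_lhs => rw [hN, map_rowMul_inf_ker, ← hA]
      conv_rhs => rw [hN, inf_right_comm, map_rowMul_inf_ker, ← hB, inf_right_comm]
    have hD : D ≠ ⊥ := by
      intro h0
      rw [h0, finrank_bot] at hND
      omega
    obtain ⟨s, hs⟩ := hNS.eq_smul_one_of_stabilizes hX hnd hD (A := (B⁻¹ * A).val) (by
      intro g hg
      have h0 : D.map (rowMul (B⁻¹ * A).val) = D := by
        rw [map_rowMul_mul, hAB, ← map_rowMul_mul, inv_mul_cancel, map_rowMul_one]
      rw [← h0]
      exact ⟨g, hg, rfl⟩)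
    have hle : C' ≤ C.map (rowMul B.val) := by
      refine (hC'.2.le_inf_ker_sup_inf_ker hΓX hz hw hzw).trans (sup_le ?_ ?_)
      · rw [hA]
        rintro _ ⟨g, hg, rfl⟩
        refine ⟨rowMul (B⁻¹ * A).val g, ?_, ?_⟩
        · rw [hs, rowMul_smul_one]
          exact C.smul_mem _ hg.1
        · rw [← LinearMap.comp_apply, ← rowMul_mul, ← Units.val_mul, mul_inv_cancel_left]
      · rw [hB]
        exact Submodule.map_mono inf_le_left
    refine Quotient.sound ((equiv_iff_colSpace hid hC.1).2
      ⟨B, Submodule.eq_of_le_of_finrank_eq hle ?_⟩)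
    rw [← (Submodule.equivMapOfInjective _ (rowMul_injective B) _).finrank_eq]
    exact hC'.1.trans hC.1.symm
  · rintro ⟨⟨M₁⟩, ⟨M₂⟩⟩ ⟨hM₁, hM₂, heq⟩
    have hC₁ := (hS1 M₁).1 hM₁
    have hC₂ := (hS2 M₂).1 hM₂
    obtain ⟨N₁, hN₁, h1, h1'⟩ := hP12 M₁ hC₁
    obtain ⟨N₂, hN₂, h2, h2'⟩ := hP21 M₂ hC₂
    have e : (⟦N₂⟧ : LinClass k W₁₂ (a + 1) c) = ⟦N₁⟧ := h2.symm.trans (heq.symm.trans h1)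
    obtain ⟨A, hA⟩ := (equiv_iff_colSpace (f := g₂ ∘ₗ f₂) (hg₂.comp hf₂) h2'.1).1
      (Quotient.exact e)
    -- After a row operation, the two matrices have the same further projection.
    have hM₂' : (⟦act A.val (1 : GL (Fin b') k).val M₂⟧ : LinClass k W₂ (a + 1) b') = ⟦M₂⟧ :=
      Quotient.sound (Setoid.symm ⟨A, 1, rfl⟩)
    have hC₂' := (hS2 (act A.val (1 : GL (Fin b') k).val M₂)).1 (by rw [hM₂']; exact hM₂)
    have hcol := colSpace_act f₂ A (1 : GL (Fin b') k) M₂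
    rw [hcomm] at hA hN₂
    rw [hN₁, hN₂, map_rowMul_inf_ker, ← hcol] at hA
    generalize act A.val (1 : GL (Fin b') k).val M₂ = M₂' at *
    set C₁ := colSpace f₁ M₁
    set C₂ := colSpace f₂ M₂'
    rw [hker₁] at hC₁
    rw [hker₂] at hC₂'
    have hD : Module.finrank k
        (C₁ ⊓ LinearMap.ker (evalCol (a + 1) w.rep) : Submodule k _) = c := by
      rw [← hN₁]
      exact h1'.1
    have hz₁ : C₁ ≤ LinearMap.ker (evalCol (a + 1) z.rep) := fun g hg =>
      hC₁.2.vanish g hg _ (Submodule.mem_span_singleton_self _)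
    have hw₂ : C₂ ≤ LinearMap.ker (evalCol (a + 1) w.rep) := fun g hg =>
      hC₂'.2.vanish g hg _ (Submodule.mem_span_singleton_self _)
    have hinf : C₁ ⊓ C₂ = C₁ ⊓ LinearMap.ker (evalCol (a + 1) w.rep) :=
      le_antisymm (inf_le_inf_left _ hw₂) (le_inf inf_le_left (hA.le.trans inf_le_left))
    have hCz : C₁ = (C₁ ⊔ C₂) ⊓ LinearMap.ker (evalCol (a + 1) z.rep) := by
      rw [sup_inf_assoc_of_le _ hz₁, ← hA]
      exact (sup_eq_left.2 inf_le_left).symm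
    have hCw : C₂ = (C₁ ⊔ C₂) ⊓ LinearMap.ker (evalCol (a + 1) w.rep) := by
      rw [sup_comm, sup_inf_assoc_of_le _ hw₂, hA]
      exact (sup_eq_left.2 inf_le_left).symm
    have hD0 : C₁ ⊓ C₂ ≠ ⊥ := by
      intro h0
      rw [← hinf, h0, finrank_bot] at hD
      omega
    obtain ⟨g, hg, hg0⟩ := Submodule.exists_mem_ne_zero_of_ne_bot hD0
    have hS := IsScrollSpace.sup hzw hC₁.2 hC₂'.2 hX hnd hz hw hΓcol hg.1 hg.2 hg0
    have hdim : Module.finrank k (C₁ ⊔ C₂ : Submodule k _) = b := by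
      have := Submodule.finrank_sup_add_finrank_inf_eq C₁ C₂
      rw [hinf, hD, hC₁.1, hC₂'.1] at this
      omega
    obtain ⟨M, hM⟩ := exists_colSpace_eq (f := LinearMap.id) hid (C := C₁ ⊔ C₂)
      (by rw [LinearMap.ker_id]; exact hS.vanish) hdim
    rw [← hM] at hS hdim hCz hCw
    refine ⟨⟦M⟧, (hS0 M).2 ⟨hdim, hS⟩, Prod.ext ?_ ?_⟩
    · have := innerProj_mk_eq (f := LinearMap.id) hid hf₁ hΓX hz (hrep z) hk1 hb hdim
        (by rwa [LinearMap.ker_id]) (N := M₁) (by rw [LinearMap.comp_id]; exact hCz)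
      exact this.1
    · have := innerProj_mk_eq (f := LinearMap.id) hid hf₂ hΓX hw (hrep w) hk2 hb hdim
        (by rwa [LinearMap.ker_id]) (N := M₂') (by rw [LinearMap.comp_id]; exact hCw)
      exact this.1.trans hM₂'

theorem scrollSet_eq_empty [FiniteDimensional k W] (hb : Module.finrank k W < b)
    (X Γ : Set (ℙ k W)) : scrollSet (a + 1) b X Γ = ∅ := by
  refine Set.eq_empty_iff_forall_notMem.2 ?_
  rintro _ ⟨M, -, ⟨hM, -⟩, -⟩
  exact absurd hM.le_finrank (not_le.2 hb)

end Gluing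

end ScrollGluing

theorem mainTheorem4 {k : Type*} [Field k] [IsAlgClosed k] [CharZero k]
    {V : Type*} [AddCommGroup V] [Module k V] [FiniteDimensional k V]
    (X : Set (ℙ k V)) (hX : ScrollGluing.IsProjVariety X)
    (hnd : ScrollGluing.IsNondegenerate X)
    (p q n : ℕ) (hp : 3 ≤ p) (hq : 1 ≤ q) :
    ∃ U : Set (Fin n → ℙ k V),
      IsOpen[ScrollGluing.zariskiPi k V n] U ∧
      {P | ∀ i, P i ∈ X} ⊆ @closure _ (ScrollGluing.zariskiPi k V n) (U ∩ {P | ∀ i, P i ∈ X}) ∧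
      ∀ P ∈ U, (∀ i, P i ∈ X) → Function.Injective P → ∀ i j : Fin n, i ≠ j →
        let Γ : Set (ℙ k V) := Set.range P
        let z : ℙ k V := P i
        let w : ℙ k V := P j
        let Λz : Submodule k V := z.submodule
        let Λw : Submodule k V := w.submodule
        let Λ : Submodule k V := Λz ⊔ Λw
        let Sz := ScrollGluing.scrollClasses (p - 1) q
          (ScrollGluing.projVariety Λz X) (ScrollGluing.projSet Λz Γ)
        let Sw := ScrollGluing.scrollClasses (p - 1) q
          (ScrollGluing.projVariety Λw X) (ScrollGluing.projSet Λw Γ)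
        let Szw := ScrollGluing.scrollClasses (p - 2) q
          (ScrollGluing.projVariety Λ X) (ScrollGluing.projSet Λ Γ)
        let πz : ScrollGluing.LinClass k V (q + 1) (p + q) →
            ScrollGluing.LinClass k (V ⧸ Λz) (q + 1) (p - 1 + q) :=
          ScrollGluing.innerProj Λz.mkQ z.rep (by omega)
        let πw : ScrollGluing.LinClass k V (q + 1) (p + q) →
            ScrollGluing.LinClass k (V ⧸ Λw) (q + 1) (p - 1 + q) :=
          ScrollGluing.innerProj Λw.mkQ w.rep (by omega)
        let πwbar : ScrollGluing.LinClass k (V ⧸ Λz) (q + 1) (p - 1 + q) →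
            ScrollGluing.LinClass k (V ⧸ Λ) (q + 1) (p - 2 + q) :=
          ScrollGluing.innerProj (Submodule.factor (le_sup_left : Λz ≤ Λ)) (Λz.mkQ w.rep)
            (by omega)
        let πzbar : ScrollGluing.LinClass k (V ⧸ Λw) (q + 1) (p - 1 + q) →
            ScrollGluing.LinClass k (V ⧸ Λ) (q + 1) (p - 2 + q) :=
          ScrollGluing.innerProj (Submodule.factor (le_sup_right : Λw ≤ Λ)) (Λw.mkQ z.rep)
            (by omega)
        Set.MapsTo πwbar Sz Szw ∧ Set.MapsTo πzbar Sw Szw ∧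
        Set.BijOn (fun c => (πz c, πw c)) (ScrollGluing.scrollClasses p q X Γ)
          {c | c.1 ∈ Sz ∧ c.2 ∈ Sw ∧ πwbar c.1 = πzbar c.2} := by
  -- When `V` has dimension at most two, there are no scroll matrices of the sizes in question.
  by_cases hV : 3 ≤ Module.finrank k V
  · refine ⟨ScrollGluing.noThreeCollinear k V n, ScrollGluing.isOpen_noThreeCollinear n,
      ScrollGluing.subset_closure_noThreeCollinear hX.2 hnd hV n, ?_⟩
    intro P hPU hPX hPinj i j hij Γ z w Λz Λw Λ Sz Sw Szw πz πw πwbar πzbar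
    have hΓX : Γ ⊆ X := by
      rintro _ ⟨l, rfl⟩
      exact hPX l
    have hΓ : Γ.Finite := Set.finite_range P
    have hz : z ∈ Γ := ⟨i, rfl⟩
    have hw : w ∈ Γ := ⟨j, rfl⟩
    have hzw : z ≠ w := hPinj.ne hij
    have hcol : ∀ u ∈ Γ, ∀ y ∈ Γ, ∀ y' ∈ Γ, y ≠ u → y' ≠ u → y' ≠ y →
        y'.rep ∉ Submodule.span k {u.rep} ⊔ Submodule.span k {y.rep} := by
      rintro _ ⟨l, rfl⟩ _ ⟨m, rfl⟩ _ ⟨m', rfl⟩ h1 h2 h3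
      have h := hPU m' l m (fun h => h2 (h ▸ rfl)) (fun h => h3 (h ▸ rfl)) fun h => h1 (h ▸ rfl)
      have h4 := (linearIndependent_finCons.1 h).2
      rwa [Matrix.range_cons, Matrix.range_cons, Matrix.range_empty, Set.union_empty,
        Submodule.span_union] at h4
    have hΛz : Λz = Submodule.span k {z.rep} := z.submodule_eq
    have hΛw : Λw = Submodule.span k {w.rep} := w.submodule_eq
    have hc1 : Submodule.factor (le_sup_left : Λz ≤ Λ) ∘ₗ Λz.mkQ = Λ.mkQ :=
      Submodule.factor_comp_mk _
    have hc2 : Submodule.factor (le_sup_right : Λw ≤ Λ) ∘ₗ Λw.mkQ = Λ.mkQ :=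
      Submodule.factor_comp_mk _
    have hs1 : Function.Surjective (Submodule.factor (le_sup_left : Λz ≤ Λ)) :=
      Submodule.factor_surjective _
    have hs2 : Function.Surjective (Submodule.factor (le_sup_right : Λw ≤ Λ)) :=
      Submodule.factor_surjective _
    have hkΛ : LinearMap.ker Λ.mkQ = Submodule.span k {z.rep} ⊔ Submodule.span k {w.rep} := by
      rw [Submodule.ker_mkQ, ← hΛz, ← hΛw]
    have hkz : LinearMap.ker Λz.mkQ = Submodule.span k {z.rep} := by rw [Submodule.ker_mkQ, hΛz]
    have hkw : LinearMap.ker Λw.mkQ = Submodule.span k {w.rep} := by rw [Submodule.ker_mkQ, hΛw]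
    refine ⟨?_, ?_, ?_⟩
    · have := ScrollGluing.mapsTo_innerProj (a := q) (b := p - 1 + q) (b' := p - 2 + q)
        Λz.mkQ_surjective hs1 hΓX hΓ hw
        (by rw [hkz]; exact ScrollGluing.rep_notMem_span hzw.symm)
        (by rw [hc1, hkΛ, hkz]) (by omega)
        (ScrollGluing.minorsVanish_projVariety_iff Λz X)
        (by rw [hc1]; exact ScrollGluing.minorsVanish_projVariety_iff Λ X)
      rw [hc1] at this
      exact this
    · have := ScrollGluing.mapsTo_innerProj (a := q) (b := p - 1 + q) (b' := p - 2 + q)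
        Λw.mkQ_surjective hs2 hΓX hΓ hz
        (by rw [hkw]; exact ScrollGluing.rep_notMem_span hzw)
        (by rw [hc2, hkΛ, hkw, sup_comm]) (by omega)
        (ScrollGluing.minorsVanish_projVariety_iff Λw X)
        (by rw [hc2]; exact ScrollGluing.minorsVanish_projVariety_iff Λ X)
      rw [hc2] at this
      exact this
    · exact ScrollGluing.bijOn_innerProj (a := q) (b := p + q) (b' := p - 1 + q) (c := p - 2 + q)
        Λz.mkQ_surjective Λw.mkQ_surjective hs1 hs2 (hc2.trans hc1.symm) hX.2 hnd hΓX hΓ hz hw hzw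
        hcol hkz hkw (by rw [hc1, hkΛ]) (by omega) (by omega) (by omega)
        (ScrollGluing.minorsVanish_projVariety_iff Λz X)
        (ScrollGluing.minorsVanish_projVariety_iff Λw X)
  · refine ⟨Set.univ, @isOpen_univ _ (ScrollGluing.zariskiPi k V n), fun P hP => ?_, ?_⟩
    · rw [Set.univ_inter]
      exact @subset_closure _ (ScrollGluing.zariskiPi k V n) _ _ hP
    intro P _ _ _ i j _ Γ z w Λz Λw Λ Sz Sw Szw πz πw πwbar πzbar
    have hS : ScrollGluing.scrollClasses p q X Γ = ∅ :=
      ScrollGluing.scrollSet_eq_empty (a := q) (b := p + q) (by omega) X Γ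
    have hSz : Sz = ∅ := by
      have := Λz.finrank_quotient_le
      exact ScrollGluing.scrollSet_eq_empty (a := q) (b := p - 1 + q) (by omega) _ _
    have hSw : Sw = ∅ := by
      have := Λw.finrank_quotient_le
      exact ScrollGluing.scrollSet_eq_empty (a := q) (b := p - 1 + q) (by omega) _ _
    have hT : {c : ScrollGluing.LinClass k (V ⧸ Λz) (q + 1) (p - 1 + q) ×
        ScrollGluing.LinClass k (V ⧸ Λw) (q + 1) (p - 1 + q) |
        c.1 ∈ Sz ∧ c.2 ∈ Sw ∧ πwbar c.1 = πzbar c.2} = ∅ :=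
      Set.eq_empty_iff_forall_notMem.2 fun c hc => by
        have := hc.1
        rw [hSz] at this
        exact this
    refine ⟨?_, ?_, ?_⟩
    · rw [hSz]
      exact Set.mapsTo_empty _ _
    · rw [hSw]
      exact Set.mapsTo_empty _ _
    · rw [hS, hT]
      exact Set.bijOn_empty _
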